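/- Let $n\ge 1$, $m>0$, $\alpha\in\mathbb R$, and let $D=(D_1,\dots,D_n)$ with $D_j=\frac1i\frac{\partial}{\partial x_j}$ on $\mathbb R^n$, $D'=(D_2,\dots,D_n)$. For real functions $\sigma,f$ and $\varphi\in L^2(\mathbb R^n)$, $\sigma(D)e^{itf(D)}\varphi$ denotes the image of $\varphi$ under the Fourier multiplier with symbol $\sigma(\xi)e^{itf(\xi)}$, understood for each $t\in\mathbb R$ as a tempered distribution on $\mathbb R^n$. (i) If $(m-n)/2<\alpha<(m-1)/2$, then there is a constant $C$, depending only on $n,m,\alpha$, such that for every $\varphi\in L^2(\mathbb R^n)$ the family $|D|^\alpha e^{it|D|^m}\varphi$ is given, for almost every $t$, by a function measurable in $(t,x)\in\mathbb R\times\mathbb R^n$, and $$\big\||x|^{\alpha-m/2}|D|^\alpha e^{it|D|^m}\varphi(x)\big\|_{L^2(\mathbb R_t\times\mathbb R^n_x)}\le C\|\varphi\|_{L^2(\mathbb R^n)}.$$ (ii) If $(m-n+1)/2<\alpha<(m-1)/2$, then there is a constant $C$, depending only on $n,m,\alpha$, such that for every $\varphi\in L^2(\mathbb R^n)$ the family $|D'|^\alpha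 e^{it(|D_1|^m-|D'|^m)}\varphi$ is given, for almost every $t$, by a function measurable in $(t,x)\in\mathbb R\times\mathbb R^n$, and $$\big\||x|^{\alpha-m/2}|D'|^\alpha e^{it(|D_1|^m-|D'|^m)}\varphi(x)\big\|_{L^2(\mathbb R_t\times\mathbb R^n_x)}\le C\|\varphi\|_{L^2(\mathbb R^n)}.$$ -/

import Mathlib

open MeasureTheory
open scoped FourierTransform SchwartzMap ENNReal NNReal

noncomputable section

/-- `u = a(D) φ` for `φ ∈ L²(ℝⁿ)`, where `D = (D₁, …, Dₙ)` and `D_j = -i ∂/∂x_j`: the function `u`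
defines a tempered distribution, the function `a(D) φ` has on the Fourier side is tempered as well,
and the Fourier transform of `u`, which is `ψ ↦ ∫ u (𝓕 ψ)`, is this function.
Mathlib's Fourier transform has the kernel `exp (-2 π i ⟪x, ξ⟫)`, so that `D_j` is multiplication
by `2 π ξ_j` on the Fourier side. -/
def IsFourierMultiplierImage {n : ℕ} (a : EuclideanSpace ℝ (Fin n) → ℂ)
    (φ : Lp ℂ 2 (volume : Measure (EuclideanSpace ℝ (Fin n))))
    (u : EuclideanSpace ℝ (Fin n) → ℂ) : Prop :=
  ∀ ψ : 𝓢(EuclideanSpace ℝ (Fin n), ℂ),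
    Integrable (fun x => u x * (𝓕 ψ) x) ∧
    Integrable (fun ξ => a ((2 * Real.pi) • ξ) * (𝓕 φ) ξ * ψ ξ) ∧
    ∫ x, u x * (𝓕 ψ) x = ∫ ξ, a ((2 * Real.pi) • ξ) * (𝓕 φ) ξ * ψ ξ

/-- `U(t, x) = σ(D) e^{i t f(D)} φ(x)` as a measurable function of `(t, x) ∈ ℝ × ℝⁿ`. -/
def IsSmoothedEvolution {n : ℕ} (σ f : EuclideanSpace ℝ (Fin n) → ℝ)
    (φ : Lp ℂ 2 (volume : Measure (EuclideanSpace ℝ (Fin n))))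
    (U : ℝ × EuclideanSpace ℝ (Fin n) → ℂ) : Prop :=
  AEStronglyMeasurable U ∧
  ∀ᵐ t : ℝ, IsFourierMultiplierImage
    (fun ξ => (σ ξ : ℂ) * Complex.exp (Complex.I * (t : ℂ) * (f ξ : ℂ))) φ (fun x => U (t, x))

/-- The Euclidean length of `ξ' = (ξ₂, …, ξₙ)`; coordinates are numbered from `0` here. -/
def tailNorm {n : ℕ} [NeZero n] (ξ : EuclideanSpace ℝ (Fin n)) : ℝ :=
  Real.sqrt (∑ j ∈ Finset.univ.erase (0 : Fin n), ξ j ^ 2)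

/-- The estimate `‖ |x|^κ σ(D) e^{i t f(D)} φ ‖_{L²(ℝ × ℝⁿ)} ≤ C ‖φ‖_{L²(ℝⁿ)}` for all
`φ ∈ L²(ℝⁿ)`, with one constant `C`: the distribution on the left is a function, whose weighted
norm is finite and obeys the bound. -/
def WeightedSmoothingEstimate {n : ℕ} (κ : ℝ) (σ f : EuclideanSpace ℝ (Fin n) → ℝ) : Prop :=
  ∃ C : ℝ≥0, ∀ φ : Lp ℂ 2 (volume : Measure (EuclideanSpace ℝ (Fin n))),
    ∃ U : ℝ × EuclideanSpace ℝ (Fin n) → ℂ,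
      IsSmoothedEvolution σ f φ U ∧
      eLpNorm (fun p : ℝ × EuclideanSpace ℝ (Fin n) => ((‖p.2‖ ^ κ : ℝ) : ℂ) * U p) 2 volume
        ≤ C * ENNReal.ofReal ‖φ‖

end

/-!
Smoothing estimates `‖|x|^(α - m/2) |D_J|^α e^{it f(D)} φ‖ ≤ C ‖φ‖` in `L²(ℝ × ℝⁿ)`, where
`|ξ_J|` is the length of the part of `ξ` with coordinates in a set `J` of cardinality `d`, and
`f(ξ) = λ |ξ_J|^m + p(ξ)` with `p` independent of these coordinates. Both parts of the theorem are
instances of `weightedSmoothingEstimate_partialNorm`: `J` is the set of all coordinates, with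
`p = 0`, or all coordinates but one, with `p(ξ) = |ξ₁|^m` and `λ = -1`.

Put `β = m/2 - α`, so that `1/2 < β < d/2`. As `β > 0`, the weight `|x|^(-2β)` is at most
`|x_J|^(-2β)`, a superposition of the Gaussians `exp(-s |x_J|²)` with `s > 0`. For the oscillatory
integral `u(t, x) = ∫ h(ξ) e^{2πi⟨x, ξ⟩ + it f(ξ)} dξ`, expand `|u|²` and integrate it against
`exp(-ε t²) exp(-ε |x_{Jᶜ}|²) |x_J|^(-2β)`. The result is at most a quadratic form in `|h|`
whose kernel is, up to a constant,
`k_ε(f(ξ) - f(η)) ∏_{j ∉ J} k_ε(2π(ξ_j - η_j)) |ξ_J - η_J|^(2β - d)`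
with the Gaussian approximate identities `k_ε` (`exists_lintegral_gaussian_mul_evolution_le`).

Writing `|h| = |ξ_J|^α |g|`, Schur's test reduces the claim to a bound, uniform in `ε` and `ξ`, for
the integral of `|η_J|^(2α)` times this kernel in `η` (`exists_lintegral_smoothingKernel_le`).
With the coordinates of `η` outside `J` fixed, `|ξ_J - η_J|` is at least the distance of `η_J` to
the line through `ξ_J`. This distance is a homogeneous function of `η_J`, and its power `2β - d` is
integrable over the sphere exactly because `β > 1/2`. In polar coordinates what remains is
`∫ ρ^(m - 1) k_ε(c - λ ρ^m) dρ`, and the substitution `y = ρ^m` bounds it by `∫ k_ε`.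

Letting `ε → 0` gives the estimate for integrable amplitudes. General `φ` are reached by cutting
the Fourier transform off to balls: the weighted evolutions form a Cauchy sequence in
`L²(ℝ × ℝⁿ)`, and a subsequence converges in `L²(ℝⁿ)` for almost every `t`, which is enough to
identify the limit as a tempered distribution (`exists_weighted_limit_evolution`).
-/

noncomputable section

open Set

/-! ### Splitting the coordinates -/

/-- The length `(∑ j ∈ J, ξ j ^ 2) ^ (1 / 2)` of the part of `ξ` with coordinates in `J`. -/
def partialNorm {ι : Type*} (J : Finset ι) (ξ : EuclideanSpace ℝ ι) : ℝ :=
  √(∑ j ∈ J, ξ j ^ 2)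

/-- The vector with the coordinates of `b` in the directions of `J` and those of `a` in the
remaining ones. -/
def glue {ι : Type*} [DecidableEq ι] (J : Finset ι) (a : EuclideanSpace ℝ {j // j ∉ J})
    (b : EuclideanSpace ℝ {j // j ∈ J}) : EuclideanSpace ℝ ι :=
  WithLp.toLp 2 fun j => if h : j ∈ J then b ⟨j, h⟩ else a ⟨j, h⟩

section Split

variable {ι : Type*}

lemma partialNorm_nonneg (J : Finset ι) (ξ : EuclideanSpace ℝ ι) : 0 ≤ partialNorm J ξ :=
  Real.sqrt_nonneg _

lemma sq_partialNorm (J : Finset ι) (ξ : EuclideanSpace ℝ ι) :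
    partialNorm J ξ ^ 2 = ∑ j ∈ J, ξ j ^ 2 :=
  Real.sq_sqrt (Finset.sum_nonneg fun _ _ => sq_nonneg _)

@[fun_prop]
lemma continuous_partialNorm (J : Finset ι) : Continuous (partialNorm J) := by
  unfold partialNorm
  fun_prop

@[fun_prop]
lemma measurable_partialNorm [Fintype ι] (J : Finset ι) : Measurable (partialNorm J) :=
  (continuous_partialNorm J).measurable

lemma partialNorm_smul (J : Finset ι) (c : ℝ) (ξ : EuclideanSpace ℝ ι) :
    partialNorm J (c • ξ) = |c| * partialNorm J ξ := by
  simp [partialNorm, mul_pow, ← Finset.mul_sum, Real.sqrt_mul (sq_nonneg c), Real.sqrt_sq_eq_abs]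

lemma partialNorm_sub_comm (J : Finset ι) (ξ η : EuclideanSpace ℝ ι) :
    partialNorm J (ξ - η) = partialNorm J (η - ξ) := by
  rw [← neg_sub, ← neg_one_smul ℝ, partialNorm_smul]; simp

lemma partialNorm_univ [Fintype ι] (ξ : EuclideanSpace ℝ ι) :
    partialNorm Finset.univ ξ = ‖ξ‖ := by
  simp [partialNorm, EuclideanSpace.norm_eq]

lemma partialNorm_le_norm [Fintype ι] (J : Finset ι) (ξ : EuclideanSpace ℝ ι) :
    partialNorm J ξ ≤ ‖ξ‖ := by
  rw [← partialNorm_univ]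
  exact Real.sqrt_le_sqrt
    (Finset.sum_le_sum_of_subset_of_nonneg (Finset.subset_univ J) fun _ _ _ => sq_nonneg _)

variable [DecidableEq ι]

lemma glue_apply_notMem (J : Finset ι) (a : EuclideanSpace ℝ {j // j ∉ J})
    (b : EuclideanSpace ℝ {j // j ∈ J}) {j : ι} (hj : j ∉ J) : glue J a b j = a ⟨j, hj⟩ := by
  simp [glue, hj]

lemma exists_glue (J : Finset ι) (ξ : EuclideanSpace ℝ ι) : ∃ a b, ξ = glue J a b := by
  refine ⟨WithLp.toLp 2 fun j => ξ j, WithLp.toLp 2 fun j => ξ j, ?_⟩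
  ext j
  simp [glue]

lemma glue_sub (J : Finset ι) (a a' : EuclideanSpace ℝ {j // j ∉ J})
    (b b' : EuclideanSpace ℝ {j // j ∈ J}) :
    glue J a b - glue J a' b' = glue J (a - a') (b - b') := by
  ext j
  by_cases hj : j ∈ J <;> simp [glue, hj]

lemma partialNorm_glue (J : Finset ι) (a : EuclideanSpace ℝ {j // j ∉ J})
    (b : EuclideanSpace ℝ {j // j ∈ J}) : partialNorm J (glue J a b) = ‖b‖ := by
  rw [partialNorm, EuclideanSpace.norm_eq, ← Finset.sum_attach, Finset.univ_eq_attach]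
  congr 1
  exact Finset.sum_congr rfl fun j _ => by simp [glue]

@[fun_prop]
lemma measurable_glue (J : Finset ι) :
    Measurable fun p : EuclideanSpace ℝ {j // j ∉ J} × EuclideanSpace ℝ {j // j ∈ J} =>
      glue J p.1 p.2 := by
  unfold glue
  refine (WithLp.measurable_toLp _ _).comp (measurable_pi_lambda _ fun j => ?_)
  by_cases hj : j ∈ J <;> simp only [hj, dite_true, dite_false] <;> fun_prop

variable [Fintype ι]

lemma norm_le_norm_glue (J : Finset ι) (a : EuclideanSpace ℝ {j // j ∉ J})
    (b : EuclideanSpace ℝ {j // j ∈ J}) : ‖a‖ ≤ ‖glue J a b‖ := by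
  rw [EuclideanSpace.norm_eq, EuclideanSpace.norm_eq]
  refine Real.sqrt_le_sqrt ?_
  have h := Finset.sum_subtype (p := fun j => j ∉ J) (F := inferInstance) (Jᶜ) (by simp)
    (fun j => ‖glue J a b j‖ ^ 2)
  have h2 : ∑ j, ‖a j‖ ^ 2 = ∑ j ∈ Jᶜ, ‖glue J a b j‖ ^ 2 := by
    rw [h]
    exact Finset.sum_congr rfl fun j _ => by rw [glue_apply_notMem J a b j.2]
  rw [h2]
  exact Finset.sum_le_sum_of_subset_of_nonneg (Finset.subset_univ _) fun _ _ _ => by positivity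

lemma lintegral_eq_lintegral_lintegral_glue (J : Finset ι) {F : EuclideanSpace ℝ ι → ℝ≥0∞}
    (hF : Measurable F) : ∫⁻ x, F x = ∫⁻ a, ∫⁻ b, F (glue J a b) := by
  have e1 := (PiLp.volume_preserving_toLp ι).lintegral_comp hF
  have e2 : MeasurePreserving (MeasurableEquiv.piEquivPiSubtypeProd (fun _ : ι => ℝ) (· ∈ J)).symm
      (volume : Measure (({j // j ∈ J} → ℝ) × ({j // j ∉ J} → ℝ))) volume := by
    convert! (volume_preserving_piEquivPiSubtypeProd (fun _ : ι => ℝ) (· ∈ J)).symm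
  have e3 := e2.lintegral_comp (f := fun y => F (WithLp.toLp 2 y))
    (hF.comp (WithLp.measurable_toLp _ _))
  have hG : Measurable fun q : ({j // j ∈ J} → ℝ) × ({j // j ∉ J} → ℝ) =>
      F (glue J (WithLp.toLp 2 q.2) (WithLp.toLp 2 q.1)) := by
    refine hF.comp ((measurable_glue J).comp (Measurable.prodMk ?_ ?_))
    · exact (WithLp.measurable_toLp _ _).comp measurable_snd
    · exact (WithLp.measurable_toLp _ _).comp measurable_fst
  have hG1 : Measurable fun q : EuclideanSpace ℝ {j // j ∉ J} × EuclideanSpace ℝ {j // j ∈ J} =>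
      F (glue J q.1 q.2) := hF.comp (measurable_glue J)
  rw [← e1, ← e3]
  calc _ = ∫⁻ q : ({j // j ∈ J} → ℝ) × ({j // j ∉ J} → ℝ),
        F (glue J (WithLp.toLp 2 q.2) (WithLp.toLp 2 q.1)) := rfl
    _ = ∫⁻ a : {j // j ∉ J} → ℝ, ∫⁻ b : {j // j ∈ J} → ℝ,
        F (glue J (WithLp.toLp 2 a) (WithLp.toLp 2 b)) := by
      exact lintegral_prod_symm _ hG.aemeasurable
    _ = _ := by
      rw [← (PiLp.volume_preserving_toLp _).lintegral_comp hG1.lintegral_prod_right']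
      refine lintegral_congr fun a => ?_
      rw [← (PiLp.volume_preserving_toLp _).lintegral_comp]
      exact hG1.comp measurable_prodMk_left

end Split

/-! ### Polar coordinates -/

section Polar

variable {E : Type*} [NormedAddCommGroup E] [NormedSpace ℝ E] [MeasurableSpace E] [BorelSpace E]
  [FiniteDimensional ℝ E] [Nontrivial E]

lemma lintegral_polar (μ : Measure E) [μ.IsAddHaarMeasure] {F : E → ℝ≥0∞} (hF : Measurable F) :
    ∫⁻ x, F x ∂μ = ∫⁻ ω : Metric.sphere (0 : E) 1, (∫⁻ r in Ioi (0 : ℝ),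
      ENNReal.ofReal (r ^ (Module.finrank ℝ E - 1)) * F (r • (ω : E))) ∂μ.toSphere := by
  have h1 : ∫⁻ x, F x ∂μ = ∫⁻ x : ({(0)}ᶜ : Set E), F x ∂(μ.comap (↑)) := by
    rw [lintegral_subtype_comap (measurableSet_singleton _).compl, restrict_compl_singleton]
  have hG : Measurable fun p : Metric.sphere (0 : E) 1 × Ioi (0 : ℝ) => F (p.2.1 • p.1.1) := by
    refine hF.comp (Continuous.measurable ?_)
    fun_prop
  have h2 := μ.measurePreserving_homeomorphUnitSphereProd.lintegral_comp hG
  have h3 : ∀ x : ({(0)}ᶜ : Set E), ((homeomorphUnitSphereProd E x).2.1 •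
      (homeomorphUnitSphereProd E x).1.1) = x.1 := by
    intro x
    have hx : ‖(x : E)‖ ≠ 0 := norm_ne_zero_iff.2 x.2
    simp [smul_smul, mul_inv_cancel₀ hx]
  simp only [h3] at h2
  rw [h1, h2, lintegral_prod _ hG.aemeasurable]
  refine lintegral_congr fun ω => ?_
  rw [Measure.volumeIoiPow, lintegral_withDensity_eq_lintegral_mul₀]
  · simp only [Pi.mul_apply]
    rw [lintegral_subtype_comap measurableSet_Ioi
      (fun r : ℝ => ENNReal.ofReal (r ^ (Module.finrank ℝ E - 1)) * F (r • (ω : E)))]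
  · fun_prop
  · exact (hG.comp measurable_prodMk_left).aemeasurable

end Polar

/-! ### Integrals of homogeneous functions -/

lemma lintegral_Ioi_rpow_mul_one_add_rpow_lt_top {q M : ℝ} (hq : -1 < q) (hM : q + 1 < M) :
    ∫⁻ r in Ioi (0 : ℝ), ENNReal.ofReal (r ^ q * (1 + r) ^ (-M)) < ⊤ := by
  rw [← Ioc_union_Ioi_eq_Ioi zero_le_one]
  refine (lintegral_union_le _ _ _).trans_lt (ENNReal.add_lt_top.2 ⟨?_, ?_⟩)
  · have h : IntegrableOn (fun r : ℝ => r ^ q) (Ioc 0 1) := by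
      have := intervalIntegral.intervalIntegrable_rpow' (a := 0) (b := 1) hq
      rwa [intervalIntegrable_iff_integrableOn_Ioc_of_le zero_le_one] at this
    refine (setLIntegral_mono' measurableSet_Ioc fun r hr => ?_).trans_lt h.lintegral_lt_top
    refine ENNReal.ofReal_le_ofReal (mul_le_of_le_one_right (by have := hr.1; positivity) ?_)
    exact Real.rpow_le_one_of_one_le_of_nonpos (by linarith [hr.1]) (by linarith)
  · have h : IntegrableOn (fun r : ℝ => r ^ (q - M)) (Ioi 1) :=
      integrableOn_Ioi_rpow_of_lt (by linarith) one_pos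
    refine (setLIntegral_mono' measurableSet_Ioi fun r hr => ?_).trans_lt h.lintegral_lt_top
    have hr' : (1 : ℝ) < r := hr
    have hr0 : 0 < r := by linarith
    rw [sub_eq_add_neg, Real.rpow_add hr0]
    refine ENNReal.ofReal_le_ofReal (mul_le_mul_of_nonneg_left ?_ (by positivity))
    exact Real.rpow_le_rpow_of_nonpos hr0 (by linarith) (by linarith)

lemma lintegral_one_add_norm_rpow_mul_norm_rpow_lt_top {E : Type*} [NormedAddCommGroup E]
    [NormedSpace ℝ E] [MeasurableSpace E] [BorelSpace E] [FiniteDimensional ℝ E] [Nontrivial E]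
    (μ : Measure E) [μ.IsAddHaarMeasure] {γ M : ℝ} (hγ : γ < Module.finrank ℝ E)
    (hM : Module.finrank ℝ E - γ < M) :
    ∫⁻ x : E, ENNReal.ofReal ((1 + ‖x‖) ^ (-M)) * ENNReal.ofReal ‖x‖ ^ (-γ) ∂μ < ⊤ := by
  have hd : 1 ≤ Module.finrank ℝ E := Module.finrank_pos
  rw [lintegral_polar μ (by fun_prop)]
  have key : ∀ ω : Metric.sphere (0 : E) 1, (∫⁻ r in Ioi (0 : ℝ),
      ENNReal.ofReal (r ^ (Module.finrank ℝ E - 1)) * (ENNReal.ofReal ((1 + ‖r • (ω : E)‖) ^ (-M))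
        * ENNReal.ofReal ‖r • (ω : E)‖ ^ (-γ))) = ∫⁻ r in Ioi (0 : ℝ),
        ENNReal.ofReal (r ^ ((Module.finrank ℝ E : ℝ) - 1 - γ) * (1 + r) ^ (-M)) := by
    intro ω
    refine setLIntegral_congr_fun measurableSet_Ioi fun r (hr : 0 < r) => ?_
    have h1 : ‖r • (ω : E)‖ = r := by simp [norm_smul, abs_of_pos hr]
    simp only [h1]
    rw [ENNReal.ofReal_rpow_of_pos hr, ← ENNReal.ofReal_mul (by positivity),
      ← ENNReal.ofReal_mul (by positivity), sub_eq_add_neg _ γ, Real.rpow_add hr,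
      ← Nat.cast_pred hd, Real.rpow_natCast]
    ring_nf
  simp only [key, lintegral_const]
  exact ENNReal.mul_lt_top (lintegral_Ioi_rpow_mul_one_add_rpow_lt_top (by linarith)
    (by linarith)) (measure_lt_top _ _)

lemma exists_lintegral_partialNorm_rpow_lt_top {ι : Type*} [Fintype ι] [DecidableEq ι]
    {J : Finset ι} (hJ : J.Nonempty) {γ : ℝ} (hγ : γ < J.card) :
    ∃ M : ℝ, 0 < M ∧ ∀ M' ≥ M, ∫⁻ x : EuclideanSpace ℝ ι,
      ENNReal.ofReal ((1 + ‖x‖) ^ (-M')) * ENNReal.ofReal (partialNorm J x) ^ (-γ) < ⊤ := by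
  have : Nonempty {j // j ∈ J} := hJ.to_subtype
  set M : ℝ := Fintype.card ι + |γ| + 1 with hM
  have hM0 : 0 < M := by positivity
  refine ⟨2 * M, by linarith, fun M' hM' => ?_⟩
  have hdJ : Module.finrank ℝ (EuclideanSpace ℝ {j // j ∈ J}) = J.card := by simp
  have hdA : (Module.finrank ℝ (EuclideanSpace ℝ {j // j ∉ J}) : ℝ) ≤ Fintype.card ι := by
    rw [finrank_euclideanSpace]
    exact_mod_cast Fintype.card_subtype_le _
  have hJc : (J.card : ℝ) ≤ Fintype.card ι := by exact_mod_cast J.card_le_univ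
  have hB := lintegral_one_add_norm_rpow_mul_norm_rpow_lt_top
    (volume : Measure (EuclideanSpace ℝ {j // j ∈ J})) (γ := γ) (M := M) (by rwa [hdJ])
    (by rw [hdJ]; linarith [neg_abs_le γ])
  have hA := finite_integral_one_add_norm (E := EuclideanSpace ℝ {j // j ∉ J}) (μ := volume)
    (r := M) (by linarith [abs_nonneg γ])
  rw [lintegral_eq_lintegral_lintegral_glue J (by fun_prop)]
  refine lt_of_le_of_lt ?_ (ENNReal.mul_lt_top hA hB)
  rw [← lintegral_mul_const _ (by fun_prop)]
  refine lintegral_mono fun a => ?_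
  rw [← lintegral_const_mul _ (by fun_prop)]
  refine lintegral_mono fun b => ?_
  simp only [partialNorm_glue]
  rw [← mul_assoc, ← ENNReal.ofReal_mul (by positivity)]
  gcongr
  have h1 := norm_le_norm_glue J a b
  have h2 : ‖b‖ ≤ ‖glue J a b‖ := partialNorm_glue J a b ▸ partialNorm_le_norm J _
  calc (1 + ‖glue J a b‖) ^ (-M') ≤ (1 + ‖glue J a b‖) ^ (-M + -M) :=
        Real.rpow_le_rpow_of_exponent_le (by linarith [norm_nonneg (glue J a b)]) (by linarith)
    _ = (1 + ‖glue J a b‖) ^ (-M) * (1 + ‖glue J a b‖) ^ (-M) := Real.rpow_add (by positivity) _ _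
    _ ≤ _ := by
      gcongr ?_ * ?_
      · exact Real.rpow_le_rpow_of_nonpos (by positivity) (by linarith) (by linarith)
      · exact Real.rpow_le_rpow_of_nonpos (by positivity) (by linarith) (by linarith)

/-- In polar coordinates a homogeneous function factors into its integral over the sphere and a
power of the radius. -/
lemma lintegral_norm_mul_partialNorm_rpow {κ : Type*} [Fintype κ] [Nonempty κ] (J : Finset κ)
    (γ : ℝ) {F : ℝ → ℝ≥0∞} (hF : Measurable F) :
    ∫⁻ b : EuclideanSpace ℝ κ, F ‖b‖ * ENNReal.ofReal (partialNorm J b) ^ (-γ) =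
      (∫⁻ ω : Metric.sphere (0 : EuclideanSpace ℝ κ) 1,
        ENNReal.ofReal (partialNorm J ω) ^ (-γ) ∂(volume : Measure _).toSphere) *
      ∫⁻ r in Ioi (0 : ℝ), ENNReal.ofReal (r ^ ((Fintype.card κ : ℝ) - 1 - γ)) * F r := by
  have hd : 1 ≤ Fintype.card κ := Fintype.card_pos
  rw [lintegral_polar volume (by fun_prop), ← lintegral_mul_const]
  · refine lintegral_congr fun ω => ?_
    rw [← lintegral_const_mul _ (by fun_prop)]
    refine setLIntegral_congr_fun measurableSet_Ioi fun r (hr : 0 < r) => ?_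
    have h1 : ‖r • (ω : EuclideanSpace ℝ κ)‖ = r := by simp [norm_smul, abs_of_pos hr]
    simp only [h1]
    rw [partialNorm_smul, abs_of_pos hr, ENNReal.ofReal_mul hr.le,
      ENNReal.mul_rpow_of_ne_top ENNReal.ofReal_ne_top ENNReal.ofReal_ne_top,
      ENNReal.ofReal_rpow_of_pos hr, finrank_euclideanSpace, sub_eq_add_neg _ γ, Real.rpow_add hr,
      ENNReal.ofReal_mul (by positivity), ← Nat.cast_pred hd, Real.rpow_natCast]
    ring
  · exact ENNReal.continuous_rpow_const.measurable.comp (by fun_prop)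

lemma lintegral_sphere_partialNorm_rpow_lt_top {κ : Type*} [Fintype κ] [DecidableEq κ]
    {J : Finset κ} (hJ : J.Nonempty) {γ : ℝ} (hγ : γ < J.card) :
    ∫⁻ ω : Metric.sphere (0 : EuclideanSpace ℝ κ) 1,
      ENNReal.ofReal (partialNorm J ω) ^ (-γ) ∂(volume : Measure _).toSphere < ⊤ := by
  have : Nonempty κ := ⟨hJ.choose⟩
  obtain ⟨M, hM, h⟩ := exists_lintegral_partialNorm_rpow_lt_top hJ hγ
  have h := h M le_rfl
  rw [lintegral_norm_mul_partialNorm_rpow J γ (F := fun r => ENNReal.ofReal ((1 + r) ^ (-M)))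
    (by fun_prop)] at h
  refine lt_top_iff_ne_top.2 fun htop => h.ne ?_
  rw [htop, ENNReal.top_mul]
  intro h0
  rw [lintegral_eq_zero_iff (by fun_prop)] at h0
  have h1 : ∀ᵐ r ∂volume.restrict (Ioi (0 : ℝ)), False := by
    filter_upwards [h0, ae_restrict_mem measurableSet_Ioi] with r hr (hr0 : 0 < r)
    simp only [Pi.zero_apply, mul_eq_zero, ENNReal.ofReal_eq_zero] at hr
    rcases hr with hr | hr
    · exact absurd hr (not_le.2 (by positivity))
    · exact absurd hr (not_le.2 (by positivity))
  rw [Filter.eventually_false_iff_eq_bot, ae_eq_bot, Measure.restrict_eq_zero,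
    Real.volume_Ioi] at h1
  exact ENNReal.top_ne_zero h1

/-- The distance of `b` to `v` is at least its distance to the line through `v`, and after a
reflection this line is a coordinate axis. -/
lemma exists_lintegral_norm_mul_norm_sub_rpow_le {κ : Type*} [Fintype κ] {γ : ℝ} (h0 : 0 ≤ γ)
    (hγ : γ + 1 < Fintype.card κ) :
    ∃ C : ℝ≥0, ∀ (F : ℝ → ℝ≥0∞), Measurable F → ∀ v : EuclideanSpace ℝ κ,
      ∫⁻ b : EuclideanSpace ℝ κ, F ‖b‖ * ENNReal.ofReal ‖v - b‖ ^ (-γ) ≤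
        C * ∫⁻ r in Ioi (0 : ℝ), ENNReal.ofReal (r ^ ((Fintype.card κ : ℝ) - 1 - γ)) * F r := by
  classical
  have hcard : 1 < Fintype.card κ := by
    have : (1 : ℝ) < Fintype.card κ := by linarith
    exact_mod_cast this
  obtain ⟨i₀⟩ : Nonempty κ := Fintype.card_pos_iff.1 (by omega)
  set J : Finset κ := Finset.univ.erase i₀ with hJ
  have hJc : J.card = Fintype.card κ - 1 := by
    rw [hJ, Finset.card_erase_of_mem (Finset.mem_univ _), Finset.card_univ]
  have hJc' : (J.card : ℝ) = Fintype.card κ - 1 := by rw [hJc, Nat.cast_pred (by omega)]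
  have hfin := lintegral_sphere_partialNorm_rpow_lt_top (J := J) (γ := γ)
    (Finset.card_pos.1 (by omega)) (by linarith)
  have : Nonempty κ := ⟨i₀⟩
  refine ⟨(∫⁻ ω : Metric.sphere (0 : EuclideanSpace ℝ κ) 1,
    ENNReal.ofReal (partialNorm J ω) ^ (-γ) ∂(volume : Measure _).toSphere).toNNReal,
    fun F hF v => ?_⟩
  rw [ENNReal.coe_toNNReal hfin.ne, ← lintegral_norm_mul_partialNorm_rpow J γ hF]
  set w : EuclideanSpace ℝ κ := EuclideanSpace.single i₀ ‖v‖ with hw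
  set R := Submodule.reflection (Submodule.span ℝ {v - w})ᗮ
  have hRv : R v = w := Submodule.reflection_sub (by simp [hw])
  have hR := R.measurePreserving.lintegral_comp
    (f := fun b => F ‖b‖ * ENNReal.ofReal (partialNorm J b) ^ (-γ)) (by fun_prop)
  rw [← hR]
  refine lintegral_mono fun b => ?_
  simp only [LinearIsometryEquiv.norm_map]
  gcongr F ‖b‖ * ?_
  rw [ENNReal.rpow_neg, ENNReal.rpow_neg, ENNReal.inv_le_inv]
  refine ENNReal.rpow_le_rpow (ENNReal.ofReal_le_ofReal ?_) h0
  rw [← R.norm_map, map_sub, hRv]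
  refine le_trans (le_of_eq ?_) (partialNorm_le_norm J _)
  unfold partialNorm
  congr 1
  refine Finset.sum_congr rfl fun j hj => ?_
  have : j ≠ i₀ := Finset.ne_of_mem_erase hj
  simp [hw, this]

lemma lintegral_Ioi_rpow_mul_comp_le {m lam : ℝ} (hm : 0 < m) (hlam : lam ≠ 0) (c : ℝ)
    (G : ℝ → ℝ≥0∞) :
    ∫⁻ r in Ioi (0 : ℝ), ENNReal.ofReal (r ^ (m - 1)) * G (c + lam * r ^ m) ≤
      ENNReal.ofReal (|lam| * m)⁻¹ * ∫⁻ y, G y := by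
  have hinj : InjOn (fun r : ℝ => c + lam * r ^ m) (Ioi 0) := by
    intro x hx y hy hxy
    have : x ^ m = y ^ m := by simpa [hlam] using hxy
    exact (Real.rpow_left_inj (le_of_lt hx) (le_of_lt hy) hm.ne').1 this
  have hder : ∀ x ∈ Ioi (0 : ℝ), HasDerivWithinAt (fun r : ℝ => c + lam * r ^ m)
      (lam * (m * x ^ (m - 1))) (Ioi 0) x := fun x hx =>
    (((Real.hasDerivAt_rpow_const (Or.inl (ne_of_gt hx))).const_mul lam).const_add
      c).hasDerivWithinAt
  have h := lintegral_image_eq_lintegral_abs_deriv_mul measurableSet_Ioi hder hinj G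
  have h2 : ∫⁻ r in Ioi (0 : ℝ), ENNReal.ofReal |lam * (m * r ^ (m - 1))| * G (c + lam * r ^ m) =
      ENNReal.ofReal (|lam| * m) *
        ∫⁻ r in Ioi (0 : ℝ), ENNReal.ofReal (r ^ (m - 1)) * G (c + lam * r ^ m) := by
    rw [← lintegral_const_mul' _ _ ENNReal.ofReal_ne_top]
    refine setLIntegral_congr_fun measurableSet_Ioi fun r (hr : 0 < r) => ?_
    rw [← mul_assoc (ENNReal.ofReal _), ← ENNReal.ofReal_mul (by positivity), abs_mul, abs_mul,
      abs_of_pos hm, abs_of_pos (Real.rpow_pos_of_pos hr _), mul_assoc]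
  have hpos : 0 < |lam| * m := mul_pos (abs_pos.2 hlam) hm
  rw [ENNReal.ofReal_inv_of_pos hpos, ← ENNReal.mul_le_iff_le_inv
    (ENNReal.ofReal_pos.2 hpos).ne' ENNReal.ofReal_ne_top, ← h2, ← h]
  exact setLIntegral_le_lintegral _ _

/-! ### Gaussian kernels -/

/-- The Fourier transform `∫ exp (i r t - b t ^ 2) dt` of a Gaussian. -/
def gaussKernel (b r : ℝ) : ℝ := √(Real.pi / b) * Real.exp (-r ^ 2 / (4 * b))

lemma gaussKernel_nonneg (b r : ℝ) : 0 ≤ gaussKernel b r := by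
  unfold gaussKernel; positivity

lemma gaussKernel_neg (b r : ℝ) : gaussKernel b (-r) = gaussKernel b r := by
  simp [gaussKernel]

lemma continuous_gaussKernel (b : ℝ) : Continuous (gaussKernel b) := by
  unfold gaussKernel
  fun_prop

@[fun_prop]
lemma measurable_gaussKernel (b : ℝ) : Measurable (gaussKernel b) :=
  (continuous_gaussKernel b).measurable

lemma integral_exp_mul_exp_eq_gaussKernel {b : ℝ} (hb : 0 < b) (r : ℝ) :
    ∫ t : ℝ, Complex.exp (Complex.I * r * t) * Real.exp (-b * t ^ 2) = gaussKernel b r := by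
  have h := fourierIntegral_gaussian (b := (b : ℂ)) (by simpa using hb) r
  have h1 : ∀ t : ℝ, (Real.exp (-b * t ^ 2) : ℂ) = Complex.exp (-b * t ^ 2) := by
    intro t; push_cast; rfl
  simp_rw [h1, h, gaussKernel]
  rw [Real.sqrt_eq_rpow]
  push_cast [Complex.ofReal_cpow (show 0 ≤ Real.pi / b by positivity)]
  rfl

lemma lintegral_gaussKernel {b : ℝ} (hb : 0 < b) :
    ∫⁻ r, ENNReal.ofReal (gaussKernel b r) = ENNReal.ofReal (2 * Real.pi) := by
  have hb4 : 0 < 1 / (4 * b) := by positivity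
  have h1 : ∀ r, gaussKernel b r = √(Real.pi / b) * Real.exp (-(1 / (4 * b)) * r ^ 2) := by
    intro r
    rw [gaussKernel]
    congr 2
    ring
  have hint : Integrable (gaussKernel b) := by
    rw [funext h1]
    exact (integrable_exp_neg_mul_sq hb4).const_mul _
  rw [← ofReal_integral_eq_lintegral_ofReal hint (ae_of_all _ (gaussKernel_nonneg b))]
  congr 1
  simp_rw [h1]
  rw [integral_const_mul, integral_gaussian, ← Real.sqrt_mul (by positivity),
    show Real.pi / b * (Real.pi / (1 / (4 * b))) = (2 * Real.pi) ^ 2 by field_simp; ring,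
    Real.sqrt_sq (by positivity)]

lemma lintegral_gaussKernel_two_pi_mul {b : ℝ} (hb : 0 < b) (c : ℝ) :
    ∫⁻ r, ENNReal.ofReal (gaussKernel b (2 * Real.pi * (c - r))) = 1 := by
  have h2 : (0 : ℝ) < 2 * Real.pi := by positivity
  have hinj : Function.Injective fun r : ℝ => 2 * Real.pi * (c - r) := by
    intro x y h
    simpa [h2.ne'] using h
  have hder : ∀ x ∈ (univ : Set ℝ), HasDerivWithinAt (fun r : ℝ => 2 * Real.pi * (c - r))
      (2 * Real.pi * (-1)) univ x := fun x _ =>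
    (((hasDerivAt_id x).const_sub c).const_mul (2 * Real.pi)).hasDerivWithinAt
  have h := lintegral_image_eq_lintegral_abs_deriv_mul MeasurableSet.univ hder hinj.injOn
    fun y => ENNReal.ofReal (gaussKernel b y)
  have himg : (fun r : ℝ => 2 * Real.pi * (c - r)) '' univ = univ := by
    rw [image_univ]
    refine range_eq_univ.2 fun y => ⟨c - y / (2 * Real.pi), ?_⟩
    field_simp
    ring
  rw [himg, Measure.restrict_univ, lintegral_gaussKernel hb,
    lintegral_const_mul' _ _ ENNReal.ofReal_ne_top] at h
  have h3 : |2 * Real.pi * (-1)| = 2 * Real.pi := by rw [mul_neg_one, abs_neg, abs_of_pos h2]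
  rw [h3] at h
  have hne : ENNReal.ofReal (2 * Real.pi) ≠ 0 := (ENNReal.ofReal_pos.2 h2).ne'
  exact ((ENNReal.mul_right_inj hne ENNReal.ofReal_ne_top).1 (by rw [mul_one, ← h]))

lemma lintegral_prod_gaussKernel {κ : Type*} [Fintype κ] {b : ℝ} (hb : 0 < b)
    (c : EuclideanSpace ℝ κ) :
    ∫⁻ a : EuclideanSpace ℝ κ,
      ∏ j, ENNReal.ofReal (gaussKernel b (2 * Real.pi * (c j - a j))) = 1 := by
  have e := (PiLp.volume_preserving_toLp κ).lintegral_comp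
    (f := fun a => ∏ j, ENNReal.ofReal (gaussKernel b (2 * Real.pi * (c j - a j))))
    (by fun_prop)
  rw [← e]
  have hm : ∀ j, Measurable fun r => gaussKernel b (2 * Real.pi * (c j - r)) := by
    intro j; fun_prop
  have h1 : ∀ j, Integrable fun r => gaussKernel b (2 * Real.pi * (c j - r)) := by
    intro j
    rw [← lintegral_ofReal_ne_top_iff_integrable (hm j).aestronglyMeasurable
      (ae_of_all _ fun r => gaussKernel_nonneg _ _), lintegral_gaussKernel_two_pi_mul hb]
    exact ENNReal.one_ne_top
  have h2 : ∀ j, ∫ r, gaussKernel b (2 * Real.pi * (c j - r)) = 1 := by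
    intro j
    rw [integral_eq_lintegral_of_nonneg_ae (ae_of_all _ fun r => gaussKernel_nonneg _ _)
      (hm j).aestronglyMeasurable, lintegral_gaussKernel_two_pi_mul hb, ENNReal.toReal_one]
  have h3 : ∀ a : κ → ℝ, ∏ j, ENNReal.ofReal (gaussKernel b (2 * Real.pi * (c j - a j))) =
      ENNReal.ofReal (∏ j, gaussKernel b (2 * Real.pi * (c j - a j))) := fun a =>
    (ENNReal.ofReal_prod_of_nonneg fun j _ => gaussKernel_nonneg _ _).symm
  simp only [h3]
  rw [← ofReal_integral_eq_lintegral_ofReal]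
  · rw [integral_fintype_prod_volume_eq_prod
      (f := fun (j : κ) (r : ℝ) => gaussKernel b (2 * Real.pi * (c j - r)))]
    simp [h2]
  · exact Integrable.fintype_prod
      (f := fun (j : κ) (r : ℝ) => gaussKernel b (2 * Real.pi * (c j - r))) h1
  · exact ae_of_all _ fun a => Finset.prod_nonneg fun j _ => gaussKernel_nonneg _ _

/-! ### Powers as superpositions of Gaussians -/

lemma lintegral_Ioi_rpow_mul_exp {a r : ℝ} (ha : 0 < a) (hr : 0 < r) :
    ∫⁻ s in Ioi (0 : ℝ), ENNReal.ofReal (s ^ (a - 1) * Real.exp (-(r * s))) =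
      ENNReal.ofReal (r ^ (-a) * Real.Gamma a) := by
  have h := Real.integral_rpow_mul_exp_neg_mul_Ioi ha hr
  rw [← ofReal_integral_eq_lintegral_ofReal, h, one_div, Real.inv_rpow hr.le, Real.rpow_neg hr.le]
  · by_contra hcon
    rw [integral_undef hcon] at h
    have : 0 < (1 / r) ^ a * Real.Gamma a := mul_pos (by positivity) (Real.Gamma_pos_of_pos ha)
    linarith
  · filter_upwards [ae_restrict_mem measurableSet_Ioi] with s (hs : 0 < s)
    simp only [Pi.zero_apply]
    positivity

lemma lintegral_Ioi_comp_inv (G : ℝ → ℝ≥0∞) :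
    ∫⁻ s in Ioi (0 : ℝ), G s =
      ∫⁻ s in Ioi (0 : ℝ), ENNReal.ofReal (s ^ (-2 : ℝ)) * G s⁻¹ := by
  have hder : ∀ x ∈ Ioi (0 : ℝ), HasDerivWithinAt (fun r : ℝ => r⁻¹) (-(x ^ 2)⁻¹) (Ioi 0) x :=
    fun x hx => (hasDerivAt_inv (ne_of_gt hx)).hasDerivWithinAt
  have h := lintegral_image_eq_lintegral_abs_deriv_mul measurableSet_Ioi hder
    inv_injective.injOn G
  have himg : (fun r : ℝ => r⁻¹) '' Ioi 0 = Ioi 0 := by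
    ext y
    simp only [mem_image, mem_Ioi]
    exact ⟨fun ⟨x, hx, hxy⟩ => hxy ▸ inv_pos.2 hx, fun hy => ⟨y⁻¹, inv_pos.2 hy, inv_inv y⟩⟩
  rw [himg] at h
  rw [h]
  refine setLIntegral_congr_fun measurableSet_Ioi fun r (hr : 0 < r) => ?_
  rw [abs_neg, abs_of_pos (by positivity), Real.rpow_neg hr.le, Real.rpow_ofNat]

/-- The Fourier transforms of the Gaussians `exp (-s |x| ^ 2)` on a space of dimension `d` add up to
a multiple of the power `-(d - 2 β)`, just as the Gaussians add up to a multiple of the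
power `-2 β`. -/
lemma exists_lintegral_rpow_mul_gaussKernel_le {β : ℝ} {d : ℕ} (hd : 2 * β < d) :
    ∃ C : ℝ≥0, ∀ r : ℝ, 0 ≤ r →
      ∫⁻ s in Ioi (0 : ℝ), ENNReal.ofReal (s ^ (β - 1) *
        (√(Real.pi / s) ^ d * Real.exp (-(2 * Real.pi * r) ^ 2 / (4 * s)))) ≤
      C * ENNReal.ofReal r ^ (-(d - 2 * β)) := by
  set γ : ℝ := d - 2 * β with hγ
  have hγ0 : 0 < γ := by linarith
  set c : ℝ := Real.pi ^ (d / 2 : ℝ) * (Real.pi ^ (-γ) * Real.Gamma (γ / 2)) with hc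
  have hc0 : 0 < c := by
    have := Real.Gamma_pos_of_pos (half_pos hγ0)
    positivity
  refine ⟨c.toNNReal, fun r hr => ?_⟩
  rcases hr.eq_or_lt with rfl | hr
  · rw [ENNReal.ofReal_zero, ENNReal.zero_rpow_of_neg (by linarith), ENNReal.mul_top]
    · exact le_top
    · simpa using hc0
  rw [lintegral_Ioi_comp_inv]
  have hpr : 0 < (Real.pi * r) ^ 2 := by positivity
  have h1 : ∀ s ∈ Ioi (0 : ℝ), ENNReal.ofReal (s ^ (-2 : ℝ)) * ENNReal.ofReal (s⁻¹ ^ (β - 1) *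
      (√(Real.pi / s⁻¹) ^ d * Real.exp (-(2 * Real.pi * r) ^ 2 / (4 * s⁻¹)))) =
      ENNReal.ofReal (Real.pi ^ (d / 2 : ℝ)) *
        ENNReal.ofReal (s ^ (γ / 2 - 1) * Real.exp (-((Real.pi * r) ^ 2 * s))) := by
    intro s (hs : 0 < s)
    rw [← ENNReal.ofReal_mul (by positivity), ← ENNReal.ofReal_mul (by positivity)]
    congr 1
    have e1 : s⁻¹ ^ (β - 1) = s ^ (-(β - 1)) := by rw [Real.inv_rpow hs.le, Real.rpow_neg hs.le]
    have e2 : √(Real.pi / s⁻¹) ^ d = Real.pi ^ (d / 2 : ℝ) * s ^ (d / 2 : ℝ) := by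
      rw [div_inv_eq_mul, Real.sqrt_eq_rpow, ← Real.rpow_natCast, ← Real.rpow_mul (by positivity),
        Real.mul_rpow (by positivity) hs.le]
      ring_nf
    have e3 : -(2 * Real.pi * r) ^ 2 / (4 * s⁻¹) = -((Real.pi * r) ^ 2 * s) := by
      field_simp
      ring
    have e4 : s ^ (γ / 2 - 1) = s ^ (-2 : ℝ) * s ^ (-(β - 1)) * s ^ (d / 2 : ℝ) := by
      rw [← Real.rpow_add hs, ← Real.rpow_add hs, hγ]
      ring_nf
    rw [e1, e2, e3, e4]
    ring
  rw [setLIntegral_congr_fun measurableSet_Ioi h1, lintegral_const_mul' _ _ ENNReal.ofReal_ne_top,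
    lintegral_Ioi_rpow_mul_exp (half_pos hγ0) hpr, ENNReal.ofReal_rpow_of_pos hr,
    ← ENNReal.ofReal_mul (by positivity)]
  change _ ≤ ENNReal.ofReal c * _
  rw [← ENNReal.ofReal_mul hc0.le]
  refine ENNReal.ofReal_le_ofReal (le_of_eq ?_)
  rw [← Real.rpow_natCast, ← Real.rpow_mul (by positivity), Real.mul_rpow (by positivity) hr.le, hc]
  norm_num
  ring_nf

lemma rpow_norm_le_lintegral_gaussian {ι : Type*} [Fintype ι] (J : Finset ι) {β : ℝ} (hβ : 0 < β)
    (x : EuclideanSpace ℝ ι) :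
    ENNReal.ofReal (Real.Gamma β) * ENNReal.ofReal (‖x‖ ^ (-β)) ^ 2 ≤
      ∫⁻ s in Ioi (0 : ℝ), ENNReal.ofReal (s ^ (β - 1) *
        Real.exp (-(partialNorm J x ^ 2 * s))) := by
  rcases eq_or_ne x 0 with rfl | hx
  · simp [Real.zero_rpow (neg_ne_zero.2 hβ.ne')]
  have hx0 : 0 < ‖x‖ := norm_pos_iff.2 hx
  calc _ = ENNReal.ofReal ((‖x‖ ^ 2) ^ (-β) * Real.Gamma β) := by
        rw [← ENNReal.ofReal_pow (by positivity),
          ← ENNReal.ofReal_mul (Real.Gamma_pos_of_pos hβ).le, ← Real.rpow_natCast,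
          ← Real.rpow_natCast, ← Real.rpow_mul hx0.le, ← Real.rpow_mul hx0.le]
        ring_nf
    _ = _ := (lintegral_Ioi_rpow_mul_exp hβ (by positivity)).symm
    _ ≤ _ := by
      refine setLIntegral_mono' measurableSet_Ioi fun s (hs : 0 < s) => ?_
      have := partialNorm_le_norm J x
      have := partialNorm_nonneg J x
      gcongr

/-! ### Oscillatory integrals in a weighted space -/

/-- Expanding the square and integrating in `y` first bounds a weighted norm of a superposition of
characters by a quadratic form whose kernel is the transform of the weight. -/
lemma lintegral_mul_enorm_integral_sq_le {Y Ω : Type*} [MeasurableSpace Y] [MeasurableSpace Ω]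
    {μ : Measure Y} {ν : Measure Ω} [SFinite μ] [SFinite ν] {W : Y → ℝ} (hW0 : ∀ y, 0 ≤ W y)
    (hW : Integrable W μ) {χ : Y → Ω → ℂ} (hχm : Measurable (Function.uncurry χ))
    (hχ : ∀ y ω, ‖χ y ω‖ ≤ 1) {h : Ω → ℂ} (hh : Integrable h ν) :
    ∫⁻ y, ENNReal.ofReal (W y) * ‖∫ ω, h ω * χ y ω ∂ν‖ₑ ^ 2 ∂μ ≤
      ∫⁻ ω, ∫⁻ ω', ‖h ω‖ₑ * ‖h ω'‖ₑ *
        ‖∫ y, χ y ω * star (χ y ω') * (W y : ℂ) ∂μ‖ₑ ∂ν ∂ν := by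
  set u : Y → ℂ := fun y => ∫ ω, h ω * χ y ω ∂ν with hu
  set Φ : Y × (Ω × Ω) → ℂ := fun q =>
    (χ q.1 q.2.1 * star (χ q.1 q.2.2)) * ((W q.1 : ℂ) * (h q.2.1 * star (h q.2.2))) with hΦ
  have hΦint : Integrable Φ (μ.prod (ν.prod ν)) := by
    refine Integrable.bdd_mul (c := 1) ?_ ?_ (ae_of_all _ fun q => ?_)
    · exact hW.ofReal.mul_prod (hh.mul_prod (hh.norm.mono'
        (continuous_star.comp_aestronglyMeasurable hh.1) (ae_of_all _ fun ω => (norm_star _).le)))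
    · refine (Measurable.mul ?_ (continuous_star.measurable.comp ?_)).aestronglyMeasurable
      · exact hχm.comp (measurable_fst.prodMk (measurable_fst.comp measurable_snd))
      · exact hχm.comp (measurable_fst.prodMk (measurable_snd.comp measurable_snd))
    · rw [norm_mul, norm_star]
      exact mul_le_one₀ (hχ _ _) (norm_nonneg _) (hχ _ _)
  have hinner : ∀ y, ∫ p, Φ (y, p) ∂(ν.prod ν) = ((W y * ‖u y‖ ^ 2 : ℝ) : ℂ) := by
    intro y
    have e1 : ∀ p : Ω × Ω, Φ (y, p) = (W y : ℂ) * ((h p.1 * χ y p.1) * star (h p.2 * χ y p.2)) := by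
      intro p
      simp only [hΦ, star_mul]
      ring
    simp_rw [e1]
    rw [integral_const_mul, integral_prod_mul (fun ω => h ω * χ y ω) fun ω => star (h ω * χ y ω)]
    have e2 : ∫ ω, star (h ω * χ y ω) ∂ν = star (u y) := integral_conj
    rw [e2]
    have e3 : u y * star (u y) = ((‖u y‖ ^ 2 : ℝ) : ℂ) := by
      have := Complex.mul_conj' (u y)
      push_cast
      exact this
    push_cast
    rw [← Complex.ofReal_pow, ← e3]
  have hint : Integrable (fun y => ((W y * ‖u y‖ ^ 2 : ℝ) : ℂ)) μ := by
    have := hΦint.integral_prod_left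
    simpa only [hinner] using this
  have hintR : Integrable (fun y => W y * ‖u y‖ ^ 2) μ := by
    have := hint.re
    exact this
  have hpos : ∀ y, 0 ≤ W y * ‖u y‖ ^ 2 := fun y => mul_nonneg (hW0 y) (by positivity)
  have hk : ∀ p : Ω × Ω, ‖∫ y, Φ (y, p) ∂μ‖ₑ = ‖h p.1‖ₑ * ‖h p.2‖ₑ *
      ‖∫ y, χ y p.1 * star (χ y p.2) * (W y : ℂ) ∂μ‖ₑ := by
    intro p
    have : ∀ y, Φ (y, p) = (h p.1 * star (h p.2)) * (χ y p.1 * star (χ y p.2) * (W y : ℂ)) := by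
      intro y
      simp only [hΦ]
      ring
    simp_rw [this]
    have hs : ‖star (h p.2)‖ₑ = ‖h p.2‖ₑ := by rw [← ofReal_norm, norm_star, ofReal_norm]
    rw [integral_const_mul, enorm_mul, enorm_mul, hs]
  calc ∫⁻ y, ENNReal.ofReal (W y) * ‖u y‖ₑ ^ 2 ∂μ
      = ∫⁻ y, ENNReal.ofReal (W y * ‖u y‖ ^ 2) ∂μ := by
        refine lintegral_congr fun y => ?_
        rw [ENNReal.ofReal_mul (hW0 y), ENNReal.ofReal_pow (norm_nonneg _), ofReal_norm]
    _ = ENNReal.ofReal (∫ y, W y * ‖u y‖ ^ 2 ∂μ) :=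
        (ofReal_integral_eq_lintegral_ofReal hintR (ae_of_all _ hpos)).symm
    _ = ‖∫ y, ∫ p, Φ (y, p) ∂(ν.prod ν) ∂μ‖ₑ := by
        simp_rw [hinner]
        rw [integral_complex_ofReal, ← ofReal_norm, Complex.norm_real, Real.norm_eq_abs,
          abs_of_nonneg (integral_nonneg hpos)]
    _ = ‖∫ p, ∫ y, Φ (y, p) ∂μ ∂(ν.prod ν)‖ₑ := by
        rw [integral_integral_swap hΦint]
    _ ≤ ∫⁻ p, ‖∫ y, Φ (y, p) ∂μ‖ₑ ∂(ν.prod ν) := enorm_integral_le_lintegral_enorm _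
    _ ≤ ∫⁻ ω, ∫⁻ ω', ‖∫ y, Φ (y, (ω, ω')) ∂μ‖ₑ ∂ν ∂ν := lintegral_prod_le _
    _ = _ := by simp_rw [hk]

section Evolution

variable {ι : Type*} [Fintype ι]

/-- The character `exp (2 π i ⟪x, ξ⟫ + i t f(ξ))` at `p = (t, x)`. -/
def waveChar (f : EuclideanSpace ℝ ι → ℝ) (p : ℝ × EuclideanSpace ℝ ι)
    (ξ : EuclideanSpace ℝ ι) : ℂ :=
  Complex.exp (((2 * Real.pi * ∑ j, ξ j * p.2 j + f ξ * p.1 : ℝ) : ℂ) * Complex.I)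

lemma norm_waveChar (f : EuclideanSpace ℝ ι → ℝ) (p : ℝ × EuclideanSpace ℝ ι)
    (ξ : EuclideanSpace ℝ ι) : ‖waveChar f p ξ‖ = 1 := Complex.norm_exp_ofReal_mul_I _

lemma measurable_waveChar {f : EuclideanSpace ℝ ι → ℝ} (hf : Measurable f) :
    Measurable (Function.uncurry (waveChar f)) := by
  unfold waveChar Function.uncurry
  fun_prop

/-- The function `(t, x) ↦ ∫ h(ξ) exp (2 π i ⟪x, ξ⟫ + i t f(ξ)) dξ`. -/
def evolution (f : EuclideanSpace ℝ ι → ℝ) (h : EuclideanSpace ℝ ι → ℂ)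
    (p : ℝ × EuclideanSpace ℝ ι) : ℂ := ∫ ξ, h ξ * waveChar f p ξ

lemma stronglyMeasurable_evolution {f : EuclideanSpace ℝ ι → ℝ} (hf : Measurable f)
    {h : EuclideanSpace ℝ ι → ℂ} (hh : Measurable h) : StronglyMeasurable (evolution f h) := by
  have : Measurable (Function.uncurry fun p ξ => h ξ * waveChar f p ξ) :=
    (hh.comp measurable_snd).mul (measurable_waveChar hf)
  exact this.stronglyMeasurable.integral_prod_right

/-- A Gaussian weight in `(t, x)` with separate widths in all directions. -/
def gaussWeight (ε : ℝ) (b : ι → ℝ) (p : ℝ × EuclideanSpace ℝ ι) : ℝ :=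
  Real.exp (-ε * p.1 ^ 2) * Real.exp (-∑ j, b j * p.2 j ^ 2)

lemma integral_gaussWeight_space {b : ι → ℝ} (hb : ∀ j, 0 < b j) (z : EuclideanSpace ℝ ι) :
    ∫ x : EuclideanSpace ℝ ι,
      Complex.exp (Complex.I * ((2 * Real.pi * ∑ j, z j * x j : ℝ) : ℂ)) *
        (Real.exp (-∑ j, b j * x j ^ 2) : ℂ) =
      ((∏ j, gaussKernel (b j) (2 * Real.pi * z j) : ℝ) : ℂ) := by
  rw [← (PiLp.volume_preserving_toLp ι).integral_comp
    (MeasurableEquiv.toLp 2 (ι → ℝ)).measurableEmbedding]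
  have h1 : ∀ x : ι → ℝ, Complex.exp (Complex.I * ((2 * Real.pi * ∑ j, z j * x j : ℝ) : ℂ)) *
      (Real.exp (-∑ j, b j * x j ^ 2) : ℂ) =
      ∏ j, (Complex.exp (Complex.I * ((2 * Real.pi * z j : ℝ) : ℂ) * x j) *
        (Real.exp (-b j * x j ^ 2) : ℂ)) := by
    intro x
    rw [Finset.prod_mul_distrib, ← Complex.exp_sum, ← Complex.ofReal_prod, ← Real.exp_sum]
    congr 2
    · push_cast
      rw [Finset.mul_sum, Finset.mul_sum]
      exact Finset.sum_congr rfl fun j _ => by ring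
    · simp
  simp only [h1]
  rw [integral_fintype_prod_volume_eq_prod (f := fun (j : ι) (r : ℝ) =>
    Complex.exp (Complex.I * ((2 * Real.pi * z j : ℝ) : ℂ) * r) * (Real.exp (-b j * r ^ 2) : ℂ))]
  push_cast
  refine Finset.prod_congr rfl fun j _ => ?_
  rw [← integral_exp_mul_exp_eq_gaussKernel (hb j)]
  push_cast
  rfl

lemma integrable_gaussWeight {ε : ℝ} (hε : 0 < ε) {b : ι → ℝ} (hb : ∀ j, 0 < b j) :
    Integrable (gaussWeight ε b) := by
  refine (integrable_exp_neg_mul_sq hε).mul_prod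
    (g := fun x : EuclideanSpace ℝ ι => Real.exp (-∑ j, b j * x j ^ 2)) ?_
  rw [← (PiLp.volume_preserving_toLp ι).integrable_comp_emb
    (MeasurableEquiv.toLp 2 (ι → ℝ)).measurableEmbedding]
  have h1 : ((fun x : EuclideanSpace ℝ ι => Real.exp (-∑ j, b j * x j ^ 2)) ∘ WithLp.toLp 2) =
      fun x : ι → ℝ => ∏ j, Real.exp (-b j * x j ^ 2) := by
    ext x
    simp [← Real.exp_sum]
  rw [h1]
  exact Integrable.fintype_prod (f := fun (j : ι) (r : ℝ) => Real.exp (-b j * r ^ 2))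
    fun j => integrable_exp_neg_mul_sq (hb j)

lemma integral_waveChar_mul_gaussWeight {ε : ℝ} (hε : 0 < ε) {b : ι → ℝ} (hb : ∀ j, 0 < b j)
    (f : EuclideanSpace ℝ ι → ℝ) (ξ η : EuclideanSpace ℝ ι) :
    ∫ p, waveChar f p ξ * star (waveChar f p η) * (gaussWeight ε b p : ℂ) =
      ((gaussKernel ε (f ξ - f η) * ∏ j, gaussKernel (b j) (2 * Real.pi * (ξ j - η j)) : ℝ) :
        ℂ) := by
  have h1 : ∀ p : ℝ × EuclideanSpace ℝ ι,
      waveChar f p ξ * star (waveChar f p η) * (gaussWeight ε b p : ℂ) =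
      (Complex.exp (Complex.I * ((f ξ - f η : ℝ) : ℂ) * p.1) * (Real.exp (-ε * p.1 ^ 2) : ℂ)) *
      (Complex.exp (Complex.I * ((2 * Real.pi * ∑ j, (ξ - η) j * p.2 j : ℝ) : ℂ)) *
        (Real.exp (-∑ j, b j * p.2 j ^ 2) : ℂ)) := by
    intro p
    have e : star (waveChar f p η) =
        Complex.exp (-(((2 * Real.pi * ∑ j, η j * p.2 j + f η * p.1 : ℝ) : ℂ) * Complex.I)) := by
      unfold waveChar
      change (starRingEnd ℂ) _ = _
      rw [← Complex.exp_conj, map_mul, Complex.conj_ofReal, Complex.conj_I, mul_neg]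
    rw [e, waveChar, gaussWeight, ← Complex.exp_add, Complex.ofReal_mul, mul_mul_mul_comm,
      ← Complex.exp_add]
    congr 2
    have : ∑ j, (ξ - η) j * p.2 j = ∑ j, ξ j * p.2 j - ∑ j, η j * p.2 j := by
      rw [← Finset.sum_sub_distrib]
      exact Finset.sum_congr rfl fun j _ => by simp [sub_mul]
    rw [this]
    push_cast
    ring
  simp_rw [h1]
  rw [Measure.volume_eq_prod, integral_prod_mul
    (fun t : ℝ => Complex.exp (Complex.I * ((f ξ - f η : ℝ) : ℂ) * t) * (Real.exp (-ε * t ^ 2) : ℂ))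
    (fun x : EuclideanSpace ℝ ι => Complex.exp (Complex.I *
      ((2 * Real.pi * ∑ j, (ξ - η) j * x j : ℝ) : ℂ)) * (Real.exp (-∑ j, b j * x j ^ 2) : ℂ)),
    integral_exp_mul_exp_eq_gaussKernel hε, integral_gaussWeight_space hb]
  push_cast
  rfl

lemma lintegral_gaussWeight_mul_evolution_le {ε : ℝ} (hε : 0 < ε) {b : ι → ℝ} (hb : ∀ j, 0 < b j)
    {f : EuclideanSpace ℝ ι → ℝ} (hf : Measurable f) {h : EuclideanSpace ℝ ι → ℂ}
    (hh : Integrable h) :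
    ∫⁻ p, ENNReal.ofReal (gaussWeight ε b p) * ‖evolution f h p‖ₑ ^ 2 ≤
      ∫⁻ ξ, ∫⁻ η, ‖h ξ‖ₑ * ‖h η‖ₑ * (ENNReal.ofReal (gaussKernel ε (f ξ - f η)) *
        ∏ j, ENNReal.ofReal (gaussKernel (b j) (2 * Real.pi * (ξ j - η j)))) := by
  refine (lintegral_mul_enorm_integral_sq_le (fun p => by unfold gaussWeight; positivity)
    (integrable_gaussWeight hε hb) (measurable_waveChar hf)
    (fun p ξ => (norm_waveChar f p ξ).le) hh).trans (le_of_eq ?_)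
  refine lintegral_congr fun ξ => lintegral_congr fun η => ?_
  have hnn : 0 ≤ ∏ j, gaussKernel (b j) (2 * Real.pi * (ξ j - η j)) :=
    Finset.prod_nonneg fun j _ => gaussKernel_nonneg _ _
  rw [integral_waveChar_mul_gaussWeight hε hb, ← ofReal_norm (Complex.ofReal _), Complex.norm_real,
    Real.norm_of_nonneg (mul_nonneg (gaussKernel_nonneg _ _) hnn),
    ENNReal.ofReal_mul (gaussKernel_nonneg _ _),
    ENNReal.ofReal_prod_of_nonneg fun j _ => gaussKernel_nonneg _ _]

end Evolution

/-! ### The smoothing estimate for integrable data -/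

section Smoothing

lemma prod_gaussKernel_eq {ι : Type*} (J : Finset ι) (s : ℝ) (z : EuclideanSpace ℝ ι) :
    ∏ j ∈ J, gaussKernel s (2 * Real.pi * z j) = √(Real.pi / s) ^ J.card *
      Real.exp (-(2 * Real.pi * partialNorm J z) ^ 2 / (4 * s)) := by
  unfold gaussKernel
  rw [Finset.prod_mul_distrib, Finset.prod_const, ← Real.exp_sum]
  congr 2
  rw [mul_pow, sq_partialNorm, Finset.mul_sum, ← Finset.sum_neg_distrib, Finset.sum_div]
  exact Finset.sum_congr rfl fun j _ => by ring

variable {ι : Type*} [Fintype ι] [DecidableEq ι]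

/-- The kernel of the quadratic form that bounds the weighted norm, for Gaussian cut-offs of
width `ε` in `t` and in the directions outside `J`. -/
def smoothingKernel (J : Finset ι) (γ ε : ℝ) (f : EuclideanSpace ℝ ι → ℝ)
    (ξ η : EuclideanSpace ℝ ι) : ℝ≥0∞ :=
  ENNReal.ofReal (gaussKernel ε (f ξ - f η)) *
    (∏ j ∈ Jᶜ, ENNReal.ofReal (gaussKernel ε (2 * Real.pi * (ξ j - η j)))) *
    ENNReal.ofReal (partialNorm J (ξ - η)) ^ (-γ)

lemma smoothingKernel_comm (J : Finset ι) (γ ε : ℝ) (f : EuclideanSpace ℝ ι → ℝ)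
    (ξ η : EuclideanSpace ℝ ι) : smoothingKernel J γ ε f ξ η = smoothingKernel J γ ε f η ξ := by
  unfold smoothingKernel
  rw [partialNorm_sub_comm, ← neg_sub (f η), gaussKernel_neg]
  congr 2
  refine Finset.prod_congr rfl fun j _ => ?_
  rw [← neg_sub (η j), mul_neg, gaussKernel_neg]

@[fun_prop]
lemma measurable_smoothingKernel (J : Finset ι) (γ ε : ℝ) {f : EuclideanSpace ℝ ι → ℝ}
    (hf : Measurable f) : Measurable (Function.uncurry (smoothingKernel J γ ε f)) := by
  unfold smoothingKernel Function.uncurry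
  fun_prop

lemma exists_lintegral_gaussian_mul_evolution_le (J : Finset ι) {β : ℝ} (hd : 2 * β < J.card) :
    ∃ C : ℝ≥0, ∀ ε : ℝ, 0 < ε → ∀ f : EuclideanSpace ℝ ι → ℝ, Measurable f →
      ∀ h : EuclideanSpace ℝ ι → ℂ, Measurable h → Integrable h →
      ∫⁻ p : ℝ × EuclideanSpace ℝ ι,
        ENNReal.ofReal (Real.exp (-(ε * (p.1 ^ 2 + ∑ j ∈ Jᶜ, p.2 j ^ 2)))) *
          (∫⁻ s in Ioi (0 : ℝ), ENNReal.ofReal (s ^ (β - 1) *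
            Real.exp (-(partialNorm J p.2 ^ 2 * s)))) * ‖evolution f h p‖ₑ ^ 2 ≤
      C * ∫⁻ q : EuclideanSpace ℝ ι × EuclideanSpace ℝ ι,
        ‖h q.1‖ₑ * ‖h q.2‖ₑ * smoothingKernel J (J.card - 2 * β) ε f q.1 q.2 := by
  obtain ⟨C, hC⟩ := exists_lintegral_rpow_mul_gaussKernel_le hd
  refine ⟨C, fun ε hε f hf h hhm hh => ?_⟩
  have hum : Measurable (evolution f h) := (stronglyMeasurable_evolution hf hhm).measurable
  set b : ℝ → ι → ℝ := fun s j => if j ∈ J then s else ε with hb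
  have hbpos : ∀ s, 0 < s → ∀ j, 0 < b s j := by
    intro s hs j
    simp only [hb]
    split_ifs <;> assumption
  -- the superposition over `s` of the weights with width `s` in the directions of `J`
  have hw : ∀ p : ℝ × EuclideanSpace ℝ ι, ∀ s ∈ Ioi (0 : ℝ),
      ENNReal.ofReal (Real.exp (-(ε * (p.1 ^ 2 + ∑ j ∈ Jᶜ, p.2 j ^ 2)))) *
        ENNReal.ofReal (s ^ (β - 1) * Real.exp (-(partialNorm J p.2 ^ 2 * s))) =
      ENNReal.ofReal (s ^ (β - 1)) * ENNReal.ofReal (gaussWeight ε (b s) p) := by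
    intro p s (hs : 0 < s)
    rw [← ENNReal.ofReal_mul (by positivity), ← ENNReal.ofReal_mul (by positivity), gaussWeight,
      ← Real.exp_add, mul_left_comm, ← Real.exp_add]
    congr 3
    have e1 : ∑ j, b s j * p.2 j ^ 2 = s * partialNorm J p.2 ^ 2 + ε * ∑ j ∈ Jᶜ, p.2 j ^ 2 := by
      rw [← Finset.sum_add_sum_compl J, sq_partialNorm, Finset.mul_sum, Finset.mul_sum]
      congr 1
      · exact Finset.sum_congr rfl fun j hj => by simp [hb, hj]
      · exact Finset.sum_congr rfl fun j hj => by simp [hb, Finset.mem_compl.1 hj]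
    rw [e1]
    ring
  have hk : ∀ q : EuclideanSpace ℝ ι × EuclideanSpace ℝ ι, ∀ s ∈ Ioi (0 : ℝ),
      ENNReal.ofReal (s ^ (β - 1)) * ∏ j, ENNReal.ofReal (gaussKernel (b s j)
        (2 * Real.pi * (q.1 j - q.2 j))) =
      (∏ j ∈ Jᶜ, ENNReal.ofReal (gaussKernel ε (2 * Real.pi * (q.1 j - q.2 j)))) *
        ENNReal.ofReal (s ^ (β - 1) * (√(Real.pi / s) ^ J.card *
          Real.exp (-(2 * Real.pi * partialNorm J (q.1 - q.2)) ^ 2 / (4 * s)))) := by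
    intro q s (hs : 0 < s)
    rw [← Finset.prod_mul_prod_compl J, ← prod_gaussKernel_eq J s,
      ENNReal.ofReal_mul (by positivity), ENNReal.ofReal_prod_of_nonneg
        fun j _ => gaussKernel_nonneg _ _]
    have e1 : ∏ j ∈ J, ENNReal.ofReal (gaussKernel (b s j) (2 * Real.pi * (q.1 j - q.2 j))) =
        ∏ j ∈ J, ENNReal.ofReal (gaussKernel s (2 * Real.pi * (q.1 - q.2) j)) :=
      Finset.prod_congr rfl fun j hj => by simp [hb, hj]
    have e2 : ∏ j ∈ Jᶜ, ENNReal.ofReal (gaussKernel (b s j) (2 * Real.pi * (q.1 j - q.2 j))) =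
        ∏ j ∈ Jᶜ, ENNReal.ofReal (gaussKernel ε (2 * Real.pi * (q.1 j - q.2 j))) :=
      Finset.prod_congr rfl fun j hj => by simp [hb, Finset.mem_compl.1 hj]
    rw [e1, e2]
    ring
  have hbm : ∀ j, Measurable fun s => b s j := by
    intro j
    simp only [hb]
    split_ifs <;> fun_prop
  have hgw : Measurable fun r : (ℝ × EuclideanSpace ℝ ι) × ℝ => gaussWeight ε (b r.2) r.1 := by
    unfold gaussWeight
    have : ∀ j, Measurable fun r : (ℝ × EuclideanSpace ℝ ι) × ℝ => b r.2 j :=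
      fun j => (hbm j).comp measurable_snd
    fun_prop
  have hgk : Measurable fun r : (EuclideanSpace ℝ ι × EuclideanSpace ℝ ι) × ℝ =>
      ∏ j, ENNReal.ofReal (gaussKernel (b r.2 j) (2 * Real.pi * (r.1.1 j - r.1.2 j))) := by
    unfold gaussKernel
    have : ∀ j, Measurable fun r : (EuclideanSpace ℝ ι × EuclideanSpace ℝ ι) × ℝ => b r.2 j :=
      fun j => (hbm j).comp measurable_snd
    fun_prop
  calc _ = ∫⁻ p : ℝ × EuclideanSpace ℝ ι, ∫⁻ s in Ioi (0 : ℝ), ENNReal.ofReal (s ^ (β - 1)) *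
        (ENNReal.ofReal (gaussWeight ε (b s) p) * ‖evolution f h p‖ₑ ^ 2) := by
        refine lintegral_congr fun p => ?_
        rw [← lintegral_const_mul' _ _ ENNReal.ofReal_ne_top, ← lintegral_mul_const' _ _
          (by finiteness)]
        refine setLIntegral_congr_fun measurableSet_Ioi fun s hs => ?_
        simp only
        rw [hw p s hs, mul_assoc]
    _ = ∫⁻ s in Ioi (0 : ℝ), ∫⁻ p : ℝ × EuclideanSpace ℝ ι, ENNReal.ofReal (s ^ (β - 1)) *
        (ENNReal.ofReal (gaussWeight ε (b s) p) * ‖evolution f h p‖ₑ ^ 2) := by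
        refine lintegral_lintegral_swap (Measurable.aemeasurable ?_)
        unfold Function.uncurry
        fun_prop
    _ ≤ ∫⁻ s in Ioi (0 : ℝ), ∫⁻ q : EuclideanSpace ℝ ι × EuclideanSpace ℝ ι,
        ENNReal.ofReal (s ^ (β - 1)) * (‖h q.1‖ₑ * ‖h q.2‖ₑ *
          (ENNReal.ofReal (gaussKernel ε (f q.1 - f q.2)) *
          ∏ j, ENNReal.ofReal (gaussKernel (b s j) (2 * Real.pi * (q.1 j - q.2 j))))) := by
        refine setLIntegral_mono' measurableSet_Ioi fun s hs => ?_
        rw [lintegral_const_mul' _ _ ENNReal.ofReal_ne_top,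
          lintegral_const_mul' _ _ ENNReal.ofReal_ne_top]
        gcongr
        refine (lintegral_gaussWeight_mul_evolution_le hε (hbpos s hs) hf hh).trans (le_of_eq ?_)
        have := hgk.comp (measurable_prodMk_right (y := s))
        simp only [Function.comp_def] at this
        rw [Measure.volume_eq_prod, lintegral_prod]
        fun_prop
    _ = ∫⁻ q : EuclideanSpace ℝ ι × EuclideanSpace ℝ ι, ∫⁻ s in Ioi (0 : ℝ),
        ENNReal.ofReal (s ^ (β - 1)) * (‖h q.1‖ₑ * ‖h q.2‖ₑ *
          (ENNReal.ofReal (gaussKernel ε (f q.1 - f q.2)) *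
          ∏ j, ENNReal.ofReal (gaussKernel (b s j) (2 * Real.pi * (q.1 j - q.2 j))))) := by
        refine (lintegral_lintegral_swap (Measurable.aemeasurable ?_)).symm
        unfold Function.uncurry
        fun_prop
    _ ≤ ∫⁻ q : EuclideanSpace ℝ ι × EuclideanSpace ℝ ι, C * (‖h q.1‖ₑ * ‖h q.2‖ₑ *
          smoothingKernel J (J.card - 2 * β) ε f q.1 q.2) := by
        refine lintegral_mono fun q => ?_
        have e : ∀ s ∈ Ioi (0 : ℝ), ENNReal.ofReal (s ^ (β - 1)) * (‖h q.1‖ₑ * ‖h q.2‖ₑ *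
            (ENNReal.ofReal (gaussKernel ε (f q.1 - f q.2)) *
            ∏ j, ENNReal.ofReal (gaussKernel (b s j) (2 * Real.pi * (q.1 j - q.2 j))))) =
            (‖h q.1‖ₑ * ‖h q.2‖ₑ * ENNReal.ofReal (gaussKernel ε (f q.1 - f q.2)) *
            ∏ j ∈ Jᶜ, ENNReal.ofReal (gaussKernel ε (2 * Real.pi * (q.1 j - q.2 j)))) *
            ENNReal.ofReal (s ^ (β - 1) * (√(Real.pi / s) ^ J.card *
            Real.exp (-(2 * Real.pi * partialNorm J (q.1 - q.2)) ^ 2 / (4 * s)))) := by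
          intro s hs
          rw [mul_assoc _ (∏ j ∈ Jᶜ, _), ← hk q s hs]
          ring
        rw [setLIntegral_congr_fun measurableSet_Ioi e, lintegral_const_mul _ (by fun_prop)]
        refine (mul_le_mul_right (hC _ (partialNorm_nonneg J _)) _).trans (le_of_eq ?_)
        unfold smoothingKernel
        ring
    _ = _ := lintegral_const_mul' _ _ ENNReal.coe_ne_top

/-- Schur's test. Outside `J` the kernel is an approximate identity; in the directions of `J` polar
coordinates reduce the integral to one over the values of the phase. -/
lemma exists_lintegral_smoothingKernel_le (J : Finset ι) {m α β lam : ℝ} (hβ : 1 < 2 * β)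
    (hd : 2 * β < J.card) (hm : 0 < m) (hmab : m = 2 * α + 2 * β) (hlam : lam ≠ 0) :
    ∃ C : ℝ≥0, ∀ ε : ℝ, 0 < ε → ∀ p : EuclideanSpace ℝ ι → ℝ,
      (∀ ξ η : EuclideanSpace ℝ ι, (∀ j ∉ J, ξ j = η j) → p ξ = p η) → Measurable p →
      ∀ ξ, ∫⁻ η, ENNReal.ofReal (partialNorm J η) ^ (2 * α) *
        smoothingKernel J (J.card - 2 * β) ε (fun ζ => lam * partialNorm J ζ ^ m + p ζ) ξ η ≤ C := by
  obtain ⟨C, hC⟩ := exists_lintegral_norm_mul_norm_sub_rpow_le (κ := {j // j ∈ J})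
    (γ := J.card - 2 * β) (by linarith) (by simp; linarith)
  refine ⟨C * (Real.toNNReal (|lam| * m)⁻¹ * Real.toNNReal (2 * Real.pi)),
    fun ε hε p hp hpm ξ => ?_⟩
  obtain ⟨a₀, b₀, hξ⟩ := exists_glue J ξ
  rw [hξ]
  set f : EuclideanSpace ℝ ι → ℝ := fun ζ => lam * partialNorm J ζ ^ m + p ζ with hf
  have hfm : Measurable f := by fun_prop
  have hK : Measurable fun η => smoothingKernel J (J.card - 2 * β) ε f (glue J a₀ b₀) η :=
    (measurable_smoothingKernel J _ ε hfm).of_uncurry_left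
  rw [lintegral_eq_lintegral_lintegral_glue J (by fun_prop)]
  set P : EuclideanSpace ℝ {j // j ∉ J} → ℝ≥0∞ := fun a =>
    ∏ j, ENNReal.ofReal (gaussKernel ε (2 * Real.pi * (a₀ j - a j))) with hP
  set D : ℝ≥0∞ := ENNReal.ofReal (|lam| * m)⁻¹ * ENNReal.ofReal (2 * Real.pi) with hD
  have hinner : ∀ a, ∫⁻ b, ENNReal.ofReal (partialNorm J (glue J a b)) ^ (2 * α) *
      smoothingKernel J (J.card - 2 * β) ε f (glue J a₀ b₀) (glue J a b) ≤ P a * (C * D) := by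
    intro a
    set c : ℝ := f (glue J a₀ b₀) - p (glue J a 0) with hc
    set G : ℝ → ℝ≥0∞ := fun y => ENNReal.ofReal (gaussKernel ε y) with hG
    have hint : ∀ b, ENNReal.ofReal (partialNorm J (glue J a b)) ^ (2 * α) *
        smoothingKernel J (J.card - 2 * β) ε f (glue J a₀ b₀) (glue J a b) =
        P a * ((ENNReal.ofReal ‖b‖ ^ (2 * α) * G (c + (-lam) * ‖b‖ ^ m)) *
          ENNReal.ofReal ‖b₀ - b‖ ^ (-((J.card : ℝ) - 2 * β))) := by
      intro b
      have e1 : f (glue J a₀ b₀) - f (glue J a b) = c + (-lam) * ‖b‖ ^ m := by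
        have : p (glue J a b) = p (glue J a 0) := by
          refine hp _ _ fun j hj => ?_
          rw [glue_apply_notMem J _ _ hj, glue_apply_notMem J _ _ hj]
        rw [hc, ← this, hf]
        simp only [partialNorm_glue]
        ring
      have e2 : ∏ j ∈ Jᶜ, ENNReal.ofReal
          (gaussKernel ε (2 * Real.pi * (glue J a₀ b₀ j - glue J a b j))) = P a := by
        rw [Finset.prod_subtype (p := fun j => j ∉ J) (F := inferInstance) (Jᶜ) (by simp)]
        refine Finset.prod_congr rfl fun j _ => ?_
        rw [glue_apply_notMem J _ _ j.2, glue_apply_notMem J _ _ j.2]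
      unfold smoothingKernel
      rw [e1, e2, glue_sub, partialNorm_glue, partialNorm_glue]
      ring
    simp_rw [hint]
    rw [lintegral_const_mul _ (by fun_prop)]
    gcongr P a * ?_
    refine (hC (fun r => ENNReal.ofReal r ^ (2 * α) * G (c + (-lam) * r ^ m)) (by fun_prop)
      b₀).trans ?_
    gcongr (C : ℝ≥0∞) * ?_
    have h3 : ∀ r ∈ Ioi (0 : ℝ), ENNReal.ofReal (r ^ ((Fintype.card {j // j ∈ J} : ℝ) - 1 -
        (J.card - 2 * β))) * (ENNReal.ofReal r ^ (2 * α) * G (c + (-lam) * r ^ m)) =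
        ENNReal.ofReal (r ^ (m - 1)) * G (c + (-lam) * r ^ m) := by
      intro r (hr : 0 < r)
      rw [ENNReal.ofReal_rpow_of_pos hr, ← mul_assoc, ← ENNReal.ofReal_mul (by positivity),
        ← Real.rpow_add hr]
      congr 3
      simp only [Fintype.card_coe]
      linarith
    rw [setLIntegral_congr_fun measurableSet_Ioi h3]
    refine (lintegral_Ioi_rpow_mul_comp_le hm (neg_ne_zero.2 hlam) c G).trans ?_
    rw [abs_neg, hG, lintegral_gaussKernel hε]
  refine (lintegral_mono hinner).trans (le_of_eq ?_)
  rw [lintegral_mul_const _ (by fun_prop), hP, lintegral_prod_gaussKernel hε, one_mul, hD]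
  simp only [ENNReal.ofReal, ENNReal.coe_mul]

/-- The weighted estimate for an integrable amplitude `h` dominated by `|ξ_J|^α g(ξ)`. -/
lemma exists_lintegral_weight_mul_evolution_le (J : Finset ι) {m α β lam : ℝ} (hβ : 1 < 2 * β)
    (hd : 2 * β < J.card) (hm : 0 < m) (hmab : m = 2 * α + 2 * β) (hlam : lam ≠ 0)
    {p : EuclideanSpace ℝ ι → ℝ} (hp : ∀ ξ η : EuclideanSpace ℝ ι, (∀ j ∉ J, ξ j = η j) → p ξ = p η)
    (hpm : Measurable p) :
    ∃ C : ℝ≥0, ∀ g h : EuclideanSpace ℝ ι → ℂ, Measurable g → Measurable h → Integrable h →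
      (∀ ξ, ‖h ξ‖ₑ ≤ ENNReal.ofReal (partialNorm J ξ) ^ α * ‖g ξ‖ₑ) →
      ∫⁻ q : ℝ × EuclideanSpace ℝ ι, ENNReal.ofReal (‖q.2‖ ^ (-β)) ^ 2 *
        ‖evolution (fun ξ => lam * partialNorm J ξ ^ m + p ξ) h q‖ₑ ^ 2 ≤
      C * ∫⁻ ξ, ‖g ξ‖ₑ ^ 2 := by
  obtain ⟨C₁, hC₁⟩ := exists_lintegral_gaussian_mul_evolution_le J hd
  obtain ⟨C₂, hC₂⟩ := exists_lintegral_smoothingKernel_le J hβ hd hm hmab hlam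
  have hβ0 : 0 < β := by linarith
  have hΓ := Real.Gamma_pos_of_pos hβ0
  refine ⟨(Real.toNNReal (Real.Gamma β))⁻¹ * (C₁ * (C₂ + C₂)), fun g h hg hh hint hgh => ?_⟩
  set f : EuclideanSpace ℝ ι → ℝ := fun ξ => lam * partialNorm J ξ ^ m + p ξ with hf
  have hfm : Measurable f := by fun_prop
  have hum : Measurable (evolution f h) := (stronglyMeasurable_evolution hfm hh).measurable
  -- the quadratic form is bounded by Schur's test, uniformly in the width of the cut-offs
  have hquad : ∀ ε : ℝ, 0 < ε → ∫⁻ q : EuclideanSpace ℝ ι × EuclideanSpace ℝ ι,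
      ‖h q.1‖ₑ * ‖h q.2‖ₑ * smoothingKernel J (J.card - 2 * β) ε f q.1 q.2 ≤
      (C₂ + C₂) * ∫⁻ ξ, ‖g ξ‖ₑ ^ 2 := by
    intro ε hε
    set K := smoothingKernel J (J.card - 2 * β) ε f with hK
    have hKm : Measurable (Function.uncurry K) := measurable_smoothingKernel J _ ε hfm
    unfold Function.uncurry at hKm
    set A : EuclideanSpace ℝ ι → EuclideanSpace ℝ ι → ℝ≥0∞ := fun ξ η =>
      ‖g ξ‖ₑ ^ 2 * (ENNReal.ofReal (partialNorm J η) ^ (2 * α) * K ξ η) with hA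
    have hAm : Measurable (Function.uncurry A) := by
      unfold Function.uncurry
      fun_prop
    have hpt : ∀ q : EuclideanSpace ℝ ι × EuclideanSpace ℝ ι,
        ‖h q.1‖ₑ * ‖h q.2‖ₑ * K q.1 q.2 ≤ A q.1 q.2 + A q.2 q.1 := by
      intro q
      have hsq : ∀ x y : ℝ≥0∞, x * y ≤ x ^ 2 + y ^ 2 := by
        intro x y
        rcases le_total x y with hxy | hxy
        · exact (mul_le_mul_left hxy y).trans (by rw [← sq]; exact le_add_self)
        · exact (mul_le_mul_right hxy x).trans (by rw [← sq]; exact le_self_add)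
      have hr : ∀ ξ, (ENNReal.ofReal (partialNorm J ξ) ^ α) ^ 2 =
          ENNReal.ofReal (partialNorm J ξ) ^ (2 * α) := by
        intro ξ
        rw [← ENNReal.rpow_natCast, ← ENNReal.rpow_mul]
        congr 1
        push_cast
        ring
      calc ‖h q.1‖ₑ * ‖h q.2‖ₑ * K q.1 q.2
          ≤ (ENNReal.ofReal (partialNorm J q.1) ^ α * ‖g q.1‖ₑ) *
            (ENNReal.ofReal (partialNorm J q.2) ^ α * ‖g q.2‖ₑ) * K q.1 q.2 := by
              gcongr <;> exact hgh _
        _ = (‖g q.1‖ₑ * ENNReal.ofReal (partialNorm J q.2) ^ α) *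
            (‖g q.2‖ₑ * ENNReal.ofReal (partialNorm J q.1) ^ α) * K q.1 q.2 := by ring
        _ ≤ ((‖g q.1‖ₑ * ENNReal.ofReal (partialNorm J q.2) ^ α) ^ 2 +
            (‖g q.2‖ₑ * ENNReal.ofReal (partialNorm J q.1) ^ α) ^ 2) * K q.1 q.2 := by
              gcongr; exact hsq _ _
        _ = A q.1 q.2 + A q.2 q.1 := by
              simp only [hA]
              rw [mul_pow, mul_pow, hr, hr, hK, smoothingKernel_comm J _ ε f q.2 q.1]
              ring
    have hAint : ∫⁻ ξ, ∫⁻ η, A ξ η ≤ C₂ * ∫⁻ ξ, ‖g ξ‖ₑ ^ 2 := by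
      rw [mul_comm, ← lintegral_mul_const' _ _ ENNReal.coe_ne_top]
      refine lintegral_mono fun ξ => ?_
      simp only [hA]
      rw [lintegral_const_mul' _ _ (by finiteness)]
      gcongr
      exact hC₂ ε hε p hp hpm ξ
    calc _ ≤ ∫⁻ q : EuclideanSpace ℝ ι × EuclideanSpace ℝ ι, (A q.1 q.2 + A q.2 q.1) :=
          lintegral_mono hpt
      _ = (∫⁻ q : EuclideanSpace ℝ ι × EuclideanSpace ℝ ι, A q.1 q.2) +
          ∫⁻ q : EuclideanSpace ℝ ι × EuclideanSpace ℝ ι, A q.2 q.1 :=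
          lintegral_add_left hAm _
      _ = (∫⁻ ξ, ∫⁻ η, A ξ η) + ∫⁻ ξ, ∫⁻ η, A ξ η := by
          rw [Measure.volume_eq_prod,
            lintegral_prod (fun q : EuclideanSpace ℝ ι × EuclideanSpace ℝ ι => A q.1 q.2)
              hAm.aemeasurable, lintegral_prod_symm
              (fun q : EuclideanSpace ℝ ι × EuclideanSpace ℝ ι => A q.2 q.1)
              (hAm.comp measurable_swap).aemeasurable]
      _ ≤ _ := by rw [add_mul]; exact add_le_add hAint hAint
  -- the cut-offs increase to `1` as their parameter `ε = e k` tends to `0`; Fatou's lemma applies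
  set e : ℕ → ℝ := fun k => 1 / ((k : ℝ) + 1) with he
  have he0 : ∀ k, 0 < e k := fun k => by positivity
  set w : ℕ → ℝ × EuclideanSpace ℝ ι → ℝ≥0∞ := fun k q =>
    ENNReal.ofReal (Real.exp (-(e k * (q.1 ^ 2 + ∑ j ∈ Jᶜ, q.2 j ^ 2)))) with hw
  set B : ℝ × EuclideanSpace ℝ ι → ℝ≥0∞ := fun q =>
    ENNReal.ofReal (‖q.2‖ ^ (-β)) ^ 2 * ‖evolution f h q‖ₑ ^ 2 with hB
  have hcut : ∀ k, ∫⁻ q, w k q * B q ≤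
      (((Real.toNNReal (Real.Gamma β))⁻¹ * (C₁ * (C₂ + C₂)) : ℝ≥0) : ℝ≥0∞) * ∫⁻ ξ, ‖g ξ‖ₑ ^ 2 := by
    intro k
    have h1 : ENNReal.ofReal (Real.Gamma β) * ∫⁻ q, w k q * B q ≤
        C₁ * ((C₂ + C₂) * ∫⁻ ξ, ‖g ξ‖ₑ ^ 2) := by
      rw [← lintegral_const_mul' _ _ ENNReal.ofReal_ne_top]
      refine (lintegral_mono fun q => ?_).trans
        ((hC₁ (e k) (he0 k) f hfm h hh hint).trans (mul_le_mul_right (hquad (e k) (he0 k)) _))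
      calc _ = w k q * (ENNReal.ofReal (Real.Gamma β) * ENNReal.ofReal (‖q.2‖ ^ (-β)) ^ 2) *
            ‖evolution f h q‖ₑ ^ 2 := by simp only [hB]; ring
        _ ≤ _ := by
          gcongr
          exact rpow_norm_le_lintegral_gaussian J hβ0 q.2
    have hne : ENNReal.ofReal (Real.Gamma β) ≠ 0 := (ENNReal.ofReal_pos.2 hΓ).ne'
    rw [ENNReal.mul_le_iff_le_inv hne ENNReal.ofReal_ne_top] at h1
    refine h1.trans (le_of_eq ?_)
    rw [ENNReal.coe_mul, ENNReal.coe_inv (by simpa using hΓ)]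
    push_cast
    simp only [ENNReal.ofReal, mul_assoc]
  have hlim : ∀ q, Filter.Tendsto (fun k => w k q * B q) Filter.atTop (nhds (B q)) := by
    intro q
    have h1 : Filter.Tendsto e Filter.atTop (nhds 0) := tendsto_one_div_add_atTop_nhds_zero_nat
    have h2 : Filter.Tendsto (fun k => w k q) Filter.atTop (nhds 1) := by
      have := (h1.mul_const (q.1 ^ 2 + ∑ j ∈ Jᶜ, q.2 j ^ 2)).neg.rexp
      rw [zero_mul, neg_zero, Real.exp_zero] at this
      simpa using ENNReal.tendsto_ofReal this
    simpa using ENNReal.Tendsto.mul_const h2 (Or.inl one_ne_zero)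
  calc ∫⁻ q, B q = ∫⁻ q, Filter.liminf (fun k => w k q * B q) Filter.atTop :=
        lintegral_congr fun q => (hlim q).liminf_eq.symm
    _ ≤ Filter.liminf (fun k => ∫⁻ q, w k q * B q) Filter.atTop :=
        lintegral_liminf_le fun k => by fun_prop
    _ ≤ _ := Filter.liminf_le_of_le (by isBoundedDefault)
        fun b hb => by obtain ⟨k, hk⟩ := hb.exists; exact hk.trans (hcut k)

end Smoothing

/-! ### Square integrability against Schwartz functions -/

lemma sq_eLpNorm_two {X F : Type*} [MeasurableSpace X] [NormedAddCommGroup F] {μ : Measure X}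
    (f : X → F) : eLpNorm f 2 μ ^ 2 = ∫⁻ x, ‖f x‖ₑ ^ 2 ∂μ := by
  have := eLpNorm_nnreal_pow_eq_lintegral (μ := μ) (f := f) (p := 2) two_ne_zero
  rw [NNReal.coe_two, ENNReal.rpow_two] at this
  simpa using this

lemma ofReal_rpow_le_rpow_ofReal {r : ℝ} (hr : 0 ≤ r) (a : ℝ) :
    ENNReal.ofReal (r ^ a) ≤ ENNReal.ofReal r ^ a := by
  rcases hr.eq_or_lt with rfl | hr
  · rcases lt_trichotomy a 0 with ha | rfl | ha
    · simp [ENNReal.zero_rpow_of_neg ha]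
    · simp
    · simp [Real.zero_rpow ha.ne']
  · rw [ENNReal.ofReal_rpow_of_pos hr]

section Decay

variable {ι : Type*} [Fintype ι]

lemma exists_memLp_partialNorm_rpow_mul_one_add_norm {J : Finset ι} (hJ : J.Nonempty) {a : ℝ}
    (ha : -(J.card : ℝ) < 2 * a) :
    ∃ M : ℕ, MemLp (fun x : EuclideanSpace ℝ ι =>
      partialNorm J x ^ a * (1 + ‖x‖) ^ (-(M : ℝ))) 2 := by
  classical
  obtain ⟨M₀, hM₀, h⟩ := exists_lintegral_partialNorm_rpow_lt_top hJ (γ := -(2 * a)) (by linarith)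
  obtain ⟨M, hM⟩ := exists_nat_ge M₀
  refine ⟨M, Measurable.aestronglyMeasurable (by fun_prop), ?_⟩
  refine (ENNReal.pow_lt_top_iff (n := 2)).1 ?_ |>.resolve_right two_ne_zero
  rw [sq_eLpNorm_two]
  refine lt_of_le_of_lt (lintegral_mono fun x => ?_) (h (2 * M) (by linarith))
  rw [enorm_mul, mul_pow, mul_comm, ← ofReal_norm, ← ofReal_norm,
    Real.norm_of_nonneg (by positivity),
    Real.norm_of_nonneg (Real.rpow_nonneg (partialNorm_nonneg J x) a)]
  gcongr ?_ * ?_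
  · rw [← ENNReal.ofReal_pow (by positivity), ← Real.rpow_natCast, ← Real.rpow_mul (by positivity)]
    refine ENNReal.ofReal_le_ofReal (le_of_eq ?_)
    congr 1
    push_cast
    ring
  · rw [neg_neg]
    refine (pow_le_pow_left' (ofReal_rpow_le_rpow_ofReal (partialNorm_nonneg J x) a) 2).trans
      (le_of_eq ?_)
    rw [← ENNReal.rpow_natCast, ← ENNReal.rpow_mul]
    congr 1
    push_cast
    ring

lemma SchwartzMap.exists_norm_le_one_add_norm_rpow {E : Type*} [NormedAddCommGroup E]
    [NormedSpace ℝ E] (ψ : 𝓢(E, ℂ)) (M : ℕ) :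
    ∃ C : ℝ, ∀ x, ‖ψ x‖ ≤ C * (1 + ‖x‖) ^ (-(M : ℝ)) := by
  refine ⟨2 ^ M * (Finset.Iic (M, 0)).sup (fun m => SchwartzMap.seminorm ℝ m.1 m.2) ψ,
    fun x => ?_⟩
  have := SchwartzMap.one_add_le_sup_seminorm_apply (𝕜 := ℝ) (m := (M, 0)) le_rfl le_rfl ψ x
  rw [norm_iteratedFDeriv_zero] at this
  rw [Real.rpow_neg (by positivity), Real.rpow_natCast, ← div_eq_mul_inv,
    le_div_iff₀ (by positivity), mul_comm]
  exact this

lemma memLp_mul_of_one_add_norm {τ : EuclideanSpace ℝ ι → ℝ} (hτ : Measurable τ) {M : ℕ}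
    (h : MemLp (fun x => τ x * (1 + ‖x‖) ^ (-(M : ℝ))) 2) {v : EuclideanSpace ℝ ι → ℂ}
    (hv : Measurable v) {C : ℝ} (hvC : ∀ x, ‖v x‖ ≤ C * (1 + ‖x‖) ^ (-(M : ℝ))) :
    MemLp (fun x => (τ x : ℂ) * v x) 2 := by
  refine (h.const_mul C).mono (Measurable.aestronglyMeasurable (by fun_prop))
    (ae_of_all _ fun x => ?_)
  have h1 : 0 ≤ (1 + ‖x‖) ^ (-(M : ℝ)) := by positivity
  have hC : 0 ≤ C * (1 + ‖x‖) ^ (-(M : ℝ)) := (norm_nonneg _).trans (hvC x)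
  rw [norm_mul, Complex.norm_real]
  calc ‖τ x‖ * ‖v x‖ ≤ ‖τ x‖ * (C * (1 + ‖x‖) ^ (-(M : ℝ))) := by gcongr; exact hvC x
    _ = ‖C * (τ x * (1 + ‖x‖) ^ (-(M : ℝ)))‖ := by
      rw [mul_left_comm C, norm_mul (τ x), Real.norm_of_nonneg hC]

lemma memLp_mul_schwartz {τ : EuclideanSpace ℝ ι → ℝ} (hτ : Measurable τ) {M : ℕ}
    (h : MemLp (fun x => τ x * (1 + ‖x‖) ^ (-(M : ℝ))) 2) (ψ : 𝓢(EuclideanSpace ℝ ι, ℂ)) :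
    MemLp (fun x => (τ x : ℂ) * ψ x) 2 := by
  obtain ⟨C, hC⟩ := ψ.exists_norm_le_one_add_norm_rpow M
  exact memLp_mul_of_one_add_norm hτ h ψ.continuous.measurable hC

lemma memLp_norm_rpow_mul_schwartz [Nonempty ι] {β : ℝ} (hβ : 0 ≤ β)
    (ψ : 𝓢(EuclideanSpace ℝ ι, ℂ)) :
    MemLp (fun x : EuclideanSpace ℝ ι => ((‖x‖ ^ β : ℝ) : ℂ) * ψ x) 2 := by
  have hcard : (0 : ℝ) < (Finset.univ : Finset ι).card := by
    exact_mod_cast Finset.univ_nonempty.card_pos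
  obtain ⟨M, hM⟩ := exists_memLp_partialNorm_rpow_mul_one_add_norm (ι := ι)
    (J := Finset.univ) Finset.univ_nonempty (a := β) (by linarith)
  simp only [partialNorm_univ] at hM
  exact memLp_mul_schwartz (by fun_prop) hM ψ

end Decay

/-! ### The Fourier transform of the evolution -/

section Pairing

variable {ι : Type*} [Fintype ι]

lemma integral_waveChar_mul_fourier (f : EuclideanSpace ℝ ι → ℝ) (ψ : 𝓢(EuclideanSpace ℝ ι, ℂ))
    (t : ℝ) (ξ : EuclideanSpace ℝ ι) :
    ∫ x, waveChar f (t, x) ξ * (𝓕 ψ) x = Complex.exp (Complex.I * t * f ξ) * ψ ξ := by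
  have h1 : ψ ξ = ∫ x, Complex.exp (((2 * Real.pi * inner ℝ x ξ : ℝ) : ℂ) * Complex.I) *
      (𝓕 ψ) x := by
    have h2 : (𝓕⁻ (𝓕 ψ) : 𝓢(EuclideanSpace ℝ ι, ℂ)) ξ = ψ ξ := by
      rw [FourierTransform.fourierInv_fourier_eq]
    rw [← h2, SchwartzMap.fourierInv_coe, Real.fourierInv_eq']
    rfl
  rw [h1, ← integral_const_mul]
  congr 1
  ext x
  rw [← mul_assoc, waveChar, ← Complex.exp_add]
  congr 2
  have : inner ℝ x ξ = ∑ j, ξ j * x j := by simp [PiLp.inner_apply]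
  rw [this]
  push_cast
  ring

lemma integrable_mul_waveChar {f : EuclideanSpace ℝ ι → ℝ} (hf : Measurable f)
    {h : EuclideanSpace ℝ ι → ℂ} (hh : Integrable h) (p : ℝ × EuclideanSpace ℝ ι) :
    Integrable fun ξ => h ξ * waveChar f p ξ :=
  hh.mul_bdd (c := 1) (measurable_waveChar hf).of_uncurry_left.aestronglyMeasurable
    (ae_of_all _ fun ξ => (norm_waveChar f p ξ).le)

lemma integral_evolution_mul_fourier {f : EuclideanSpace ℝ ι → ℝ} (hf : Measurable f)
    {h : EuclideanSpace ℝ ι → ℂ} (hh : Integrable h) (ψ : 𝓢(EuclideanSpace ℝ ι, ℂ)) (t : ℝ) :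
    ∫ x, evolution f h (t, x) * (𝓕 ψ) x =
      ∫ ξ, h ξ * (Complex.exp (Complex.I * t * f ξ) * ψ ξ) := by
  have hint : Integrable fun q : EuclideanSpace ℝ ι × EuclideanSpace ℝ ι =>
      (h q.2 * (𝓕 ψ) q.1) * waveChar f (t, q.1) q.2 := by
    refine Integrable.mul_bdd (c := 1) ?_ ?_ (ae_of_all _ fun q => (norm_waveChar f _ _).le)
    · have := (𝓕 ψ).integrable (μ := volume).mul_prod hh
      rw [Measure.volume_eq_prod]
      simpa only [mul_comm] using this
    · exact ((measurable_waveChar hf).comp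
        ((measurable_const.prodMk measurable_fst).prodMk measurable_snd)).aestronglyMeasurable
  calc ∫ x, evolution f h (t, x) * (𝓕 ψ) x
      = ∫ x, ∫ ξ, (h ξ * (𝓕 ψ) x) * waveChar f (t, x) ξ := by
        congr 1
        ext x
        rw [evolution, ← integral_mul_const]
        congr 1
        ext ξ
        ring
    _ = ∫ ξ, ∫ x, (h ξ * (𝓕 ψ) x) * waveChar f (t, x) ξ := integral_integral_swap hint
    _ = _ := by
        congr 1
        ext ξ
        rw [← integral_waveChar_mul_fourier, ← integral_const_mul]
        congr 1
        ext x
        ring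

lemma evolution_sub {f : EuclideanSpace ℝ ι → ℝ} (hf : Measurable f)
    {h h' : EuclideanSpace ℝ ι → ℂ} (hh : Integrable h) (hh' : Integrable h')
    (p : ℝ × EuclideanSpace ℝ ι) :
    evolution f (fun ξ => h ξ - h' ξ) p = evolution f h p - evolution f h' p := by
  unfold evolution
  simp_rw [sub_mul]
  exact integral_sub (integrable_mul_waveChar hf hh p) (integrable_mul_waveChar hf hh' p)

end Pairing

/-! ### Passage to the limit -/

section Limit

open Filter Topology

lemma lintegral_sq_eLpNorm_two_slice {X Y : Type*} [MeasurableSpace X] [MeasurableSpace Y]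
    {μ : Measure X} {ν : Measure Y} [SFinite ν] {W : X × Y → ℂ} (hW : Measurable W) :
    ∫⁻ x, eLpNorm (fun y => W (x, y)) 2 ν ^ 2 ∂μ = eLpNorm W 2 (μ.prod ν) ^ 2 := by
  simp_rw [sq_eLpNorm_two]
  rw [lintegral_prod _ (by fun_prop)]

lemma measurable_sq_eLpNorm_two_slice {X Y : Type*} [MeasurableSpace X] [MeasurableSpace Y]
    {ν : Measure Y} [SFinite ν] {W : X × Y → ℂ} (hW : Measurable W) :
    Measurable fun x => eLpNorm (fun y => W (x, y)) 2 ν ^ 2 := by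
  simp_rw [sq_eLpNorm_two]
  have : Measurable fun q => ‖W q‖ₑ ^ 2 := by fun_prop
  exact this.lintegral_prod_right'

lemma ae_memLp_two_slice {X Y : Type*} [MeasurableSpace X] [MeasurableSpace Y]
    {μ : Measure X} {ν : Measure Y} [SFinite ν] {W : X × Y → ℂ} (hW : Measurable W)
    (hW2 : MemLp W 2 (μ.prod ν)) : ∀ᵐ x ∂μ, MemLp (fun y => W (x, y)) 2 ν := by
  have h := ae_lt_top (measurable_sq_eLpNorm_two_slice (ν := ν) hW)
    (by rw [lintegral_sq_eLpNorm_two_slice (μ := μ) hW]; exact (ENNReal.pow_lt_top hW2.2).ne)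
  filter_upwards [h] with x hx
  exact ⟨(hW.comp measurable_prodMk_left).aestronglyMeasurable,
    (ENNReal.pow_lt_top_iff.1 hx).resolve_right two_ne_zero⟩

/-- A sequence that converges in `L²` of a product has a subsequence that converges in `L²` on
almost every slice. -/
lemma exists_subseq_ae_tendsto_slice {X Y : Type*} [MeasurableSpace X] [MeasurableSpace Y]
    {μ : Measure X} {ν : Measure Y} [SFinite ν] {W : ℕ → X × Y → ℂ} {V : X × Y → ℂ}
    (hW : ∀ k, Measurable (W k)) (hV : Measurable V)
    (h : Tendsto (fun k => eLpNorm (W k - V) 2 (μ.prod ν)) atTop (𝓝 0)) :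
    ∃ ns : ℕ → ℕ, StrictMono ns ∧ ∀ᵐ x ∂μ,
      Tendsto (fun j => eLpNorm (fun y => W (ns j) (x, y) - V (x, y)) 2 ν) atTop (𝓝 0) := by
  have hD : ∀ k, Measurable (W k - V) := fun k => (hW k).sub hV
  have h2 : Tendsto (fun k => eLpNorm (W k - V) 2 (μ.prod ν) ^ 2) atTop (𝓝 0) := by
    have := (ENNReal.continuous_pow 2).tendsto 0 |>.comp h
    simpa [Function.comp_def] using this
  have hex : ∀ j : ℕ, ∃ N, ∀ k ≥ N, eLpNorm (W k - V) 2 (μ.prod ν) ^ 2 ≤ 2⁻¹ ^ j := by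
    intro j
    have hpos : (0 : ℝ≥0∞) < 2⁻¹ ^ j := ENNReal.pow_pos (by simp) j
    exact eventually_atTop.1 (h2.eventually (ge_mem_nhds hpos))
  obtain ⟨ns, hns, hb⟩ := extraction_forall_of_eventually' hex
  refine ⟨ns, hns, ?_⟩
  have hm : ∀ j, Measurable fun x => eLpNorm (fun y => (W (ns j) - V) (x, y)) 2 ν ^ 2 :=
    fun j => measurable_sq_eLpNorm_two_slice (hD (ns j))
  have hsum : ∫⁻ x, ∑' j, eLpNorm (fun y => (W (ns j) - V) (x, y)) 2 ν ^ 2 ∂μ ≠ ⊤ := by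
    rw [lintegral_tsum fun j => (hm j).aemeasurable]
    simp_rw [fun j => lintegral_sq_eLpNorm_two_slice (μ := μ) (ν := ν) (hD (ns j))]
    refine ne_top_of_le_ne_top ?_ (ENNReal.tsum_le_tsum hb)
    rw [ENNReal.tsum_geometric]
    simp
  filter_upwards [ae_lt_top (Measurable.tsum hm) hsum] with x hx
  have h3 := ENNReal.tendsto_atTop_zero_of_tsum_ne_top hx.ne
  have h4 := (ENNReal.continuous_rpow_const (y := (1 / 2 : ℝ))).tendsto 0 |>.comp h3
  rw [ENNReal.zero_rpow_of_pos (by norm_num)] at h4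
  refine h4.congr fun j => ?_
  simp only [Function.comp_apply]
  rw [← ENNReal.rpow_natCast, ← ENNReal.rpow_mul]
  norm_num

lemma tendsto_integral_mul_of_tendsto_eLpNorm {Y : Type*} [MeasurableSpace Y] {ν : Measure Y}
    {F : ℕ → Y → ℂ} {G v : Y → ℂ} (hF : ∀ j, MemLp (F j) 2 ν) (hG : MemLp G 2 ν)
    (hv : MemLp v 2 ν)
    (h : Tendsto (fun j => eLpNorm (fun y => F j y - G y) 2 ν) atTop (𝓝 0)) :
    Tendsto (fun j => ∫ y, F j y * v y ∂ν) atTop (𝓝 (∫ y, G y * v y ∂ν)) := by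
  refine tendsto_integral_of_L1 _ (hG.integrable_mul hv).1
    (Eventually.of_forall fun j => (hF j).integrable_mul hv) ?_
  have h2 : Tendsto (fun j => eLpNorm (fun y => F j y - G y) 2 ν * eLpNorm v 2 ν) atTop (𝓝 0) := by
    have := ENNReal.Tendsto.mul_const h (Or.inr hv.2.ne)
    rwa [zero_mul] at this
  refine tendsto_of_tendsto_of_tendsto_of_le_of_le tendsto_const_nhds h2 (fun _ => zero_le)
    fun j => ?_
  have h3 := eLpNorm_smul_le_mul_eLpNorm (p := 2) (q := 2) (r := 1) hv.1 ((hF j).1.sub hG.1)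
  rw [eLpNorm_one_eq_lintegral_enorm] at h3
  refine le_trans (le_of_eq ?_) h3
  refine lintegral_congr fun y => ?_
  simp [sub_mul]

/-- A family that depends boundedly on data converging in `L²` converges in `L²`. -/
lemma exists_measurable_tendsto_eLpNorm {X Y : Type*} [MeasurableSpace X] [MeasurableSpace Y]
    {μ : Measure X} {ν : Measure Y} {Wk : ℕ → X → ℂ} {gk : ℕ → Y → ℂ} {g : Y → ℂ}
    (hW2 : ∀ k, MemLp (Wk k) 2 μ) (hgk2 : ∀ k, MemLp (gk k) 2 ν) (hg : MemLp g 2 ν) {C : ℝ≥0}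
    (hWle : ∀ k, eLpNorm (Wk k) 2 μ ≤ C * eLpNorm (gk k) 2 ν)
    (hWsub : ∀ k l, eLpNorm (Wk k - Wk l) 2 μ ≤ C * eLpNorm (gk k - gk l) 2 ν)
    (hgkle : ∀ k y, ‖gk k y‖ ≤ ‖g y‖)
    (hgkconv : Tendsto (fun k => eLpNorm (gk k - g) 2 ν) atTop (𝓝 0)) :
    ∃ V : X → ℂ, Measurable V ∧ MemLp V 2 μ ∧ eLpNorm V 2 μ ≤ C * eLpNorm g 2 ν ∧
      Tendsto (fun k => eLpNorm (Wk k - V) 2 μ) atTop (𝓝 0) := by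
  have hgc : CauchySeq fun k => (hgk2 k).toLp (gk k) :=
    ((Lp.tendsto_Lp_iff_tendsto_eLpNorm'' gk hgk2 g hg).2 hgkconv).cauchySeq
  have hWc : CauchySeq fun k => (hW2 k).toLp (Wk k) := by
    rw [cauchySeq_iff_tendsto_dist_atTop_0] at hgc ⊢
    have h1 := hgc.const_mul (C : ℝ)
    rw [mul_zero] at h1
    refine squeeze_zero (fun _ => dist_nonneg) (fun q => ?_) h1
    rw [dist_edist, dist_edist, Lp.edist_toLp_toLp, Lp.edist_toLp_toLp, ← ENNReal.coe_toReal C,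
      ← ENNReal.toReal_mul]
    exact ENNReal.toReal_mono (ENNReal.mul_ne_top ENNReal.coe_ne_top
      ((hgk2 q.1).sub (hgk2 q.2)).2.ne) (hWsub q.1 q.2)
  obtain ⟨V, hVm, hV2, hconv⟩ : ∃ V : X → ℂ, Measurable V ∧ MemLp V 2 μ ∧
      Tendsto (fun k => eLpNorm (Wk k - V) 2 μ) atTop (𝓝 0) := by
    obtain ⟨w, hw⟩ := cauchySeq_tendsto_of_complete hWc
    refine ⟨w, (Lp.stronglyMeasurable w).measurable, Lp.memLp w, ?_⟩
    refine (Lp.tendsto_Lp_iff_tendsto_eLpNorm'' Wk hW2 w (Lp.memLp w)).1 ?_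
    rwa [Lp.toLp_coeFn]
  refine ⟨V, hVm, hV2, ?_, hconv⟩
  have h1 : ∀ k, eLpNorm V 2 μ ≤ C * eLpNorm g 2 ν + eLpNorm (Wk k - V) 2 μ := by
    intro k
    have h2 : V = Wk k - (Wk k - V) := by simp
    calc eLpNorm V 2 μ = eLpNorm (Wk k - (Wk k - V)) 2 μ := by rw [← h2]
      _ ≤ eLpNorm (Wk k) 2 μ + eLpNorm (Wk k - V) 2 μ :=
        eLpNorm_sub_le (hW2 k).1 ((hW2 k).1.sub hV2.1) (by norm_num)
      _ ≤ _ := by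
        exact add_le_add_left ((hWle k).trans (mul_le_mul_right (eLpNorm_mono (hgkle k)) _)) _
  have h3 : Tendsto (fun k => C * eLpNorm g 2 ν + eLpNorm (Wk k - V) 2 μ) atTop
      (𝓝 (C * eLpNorm g 2 ν + 0)) := tendsto_const_nhds.add hconv
  rw [add_zero] at h3
  exact ge_of_tendsto' h3 h1
variable {ι : Type*} [Fintype ι]

/-- Square integrable data are approximated by their restrictions to balls, on which the
amplitudes `σ g` are integrable. -/
lemma exists_seq_integrable_mul {σ : EuclideanSpace ℝ ι → ℝ} (hσm : Measurable σ) {M : ℕ}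
    (hσ : MemLp (fun ξ => σ ξ * (1 + ‖ξ‖) ^ (-(M : ℝ))) 2)
    {g : EuclideanSpace ℝ ι → ℂ} (hgm : Measurable g) (hg : MemLp g 2) :
    ∃ gk : ℕ → EuclideanSpace ℝ ι → ℂ, (∀ k, Measurable (gk k)) ∧ (∀ k, MemLp (gk k) 2) ∧
      (∀ k ξ, ‖gk k ξ‖ ≤ ‖g ξ‖) ∧ (∀ ξ, ∀ᶠ k in atTop, gk k ξ = g ξ) ∧
      Tendsto (fun k => eLpNorm (gk k - g) 2) atTop (𝓝 0) ∧
      ∀ k, Integrable (fun ξ => (σ ξ : ℂ) * gk k ξ) := by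
  set gk : ℕ → EuclideanSpace ℝ ι → ℂ := fun k =>
    (Metric.closedBall 0 (k : ℝ)).indicator g with hgk
  have hgkm : ∀ k, Measurable (gk k) := fun k =>
    hgm.indicator Metric.isClosed_closedBall.measurableSet
  have hgk2 : ∀ k, MemLp (gk k) 2 := fun k => hg.indicator Metric.isClosed_closedBall.measurableSet
  have hgkle : ∀ k ξ, ‖gk k ξ‖ ≤ ‖g ξ‖ := fun k ξ => norm_indicator_le_norm_self _ _
  have hgklim : ∀ ξ, ∀ᶠ k in atTop, gk k ξ = g ξ := by
    intro ξ
    obtain ⟨K, hK⟩ := exists_nat_ge ‖ξ‖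
    filter_upwards [eventually_ge_atTop K] with k hk
    refine indicator_of_mem ?_ _
    rw [mem_closedBall_zero_iff]
    exact hK.trans (by exact_mod_cast hk)
  -- the cut-off data converge in `L²`
  have hgkconv : Tendsto (fun k => eLpNorm (gk k - g) 2) atTop (𝓝 0) := by
    have h1 : Tendsto (fun k => ∫⁻ ξ, ‖gk k ξ - g ξ‖ₑ ^ 2) atTop
        (𝓝 (∫⁻ _ : EuclideanSpace ℝ ι, 0)) := by
      refine tendsto_lintegral_of_dominated_convergence (fun ξ => ‖g ξ‖ₑ ^ 2)
        (fun k => by have := hgkm k; fun_prop) (fun k => ae_of_all _ fun ξ => ?_) ?_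
        (ae_of_all _ fun ξ => ?_)
      · refine pow_le_pow_left' ?_ 2
        simp only [hgk, indicator]
        split_ifs <;> simp
      · rw [← sq_eLpNorm_two]
        exact (ENNReal.pow_lt_top hg.2).ne
      · refine tendsto_const_nhds.congr' ?_
        filter_upwards [hgklim ξ] with k hk
        simp [hk]
    rw [lintegral_zero] at h1
    have h4 := (ENNReal.continuous_rpow_const (y := (1 / 2 : ℝ))).tendsto 0 |>.comp h1
    rw [ENNReal.zero_rpow_of_pos (by norm_num)] at h4
    refine h4.congr fun k => ?_
    have h5 := sq_eLpNorm_two (μ := volume) (gk k - g)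
    simp only [Pi.sub_apply] at h5
    simp only [Function.comp_apply]
    rw [← h5, ← ENNReal.rpow_natCast, ← ENNReal.rpow_mul]
    norm_num
  refine ⟨gk, hgkm, hgk2, hgkle, hgklim, hgkconv, fun k => ?_⟩
  have h1 : MemLp (fun ξ => (σ ξ : ℂ) *
      (Metric.closedBall (0 : EuclideanSpace ℝ ι) (k : ℝ)).indicator (fun _ => (1 : ℂ)) ξ) 2 := by
    refine memLp_mul_of_one_add_norm hσm hσ
      (measurable_const.indicator Metric.isClosed_closedBall.measurableSet)
      (C := (1 + (k : ℝ)) ^ (M : ℝ)) fun x => ?_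
    by_cases hx : x ∈ Metric.closedBall (0 : EuclideanSpace ℝ ι) (k : ℝ)
    · rw [indicator_of_mem hx, norm_one, Real.rpow_neg (by positivity), ← div_eq_mul_inv,
        one_le_div (by positivity)]
      gcongr
      exact mem_closedBall_zero_iff.1 hx
    · rw [indicator_of_notMem hx, norm_zero]
      positivity
  refine (h1.integrable_mul hg).congr (ae_of_all _ fun ξ => ?_)
  simp only [Pi.mul_apply, hgk, indicator]
  split_ifs <;> simp
variable [Nonempty ι]

/-- An estimate for integrable amplitudes extends to all amplitudes `σ g` with `g` square
integrable: cutting `g` off to balls gives a Cauchy sequence in the weighted space, and along a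
subsequence it converges, for almost every `t`, strongly enough to pass to the limit in the pairing
with Schwartz functions. -/
lemma exists_weighted_limit_evolution {σ f : EuclideanSpace ℝ ι → ℝ} (hσm : Measurable σ)
    (hf : Measurable f) {β : ℝ} (hβ : 0 < β) {M : ℕ}
    (hσ : MemLp (fun ξ => σ ξ * (1 + ‖ξ‖) ^ (-(M : ℝ))) 2) {C : ℝ≥0}
    (hC : ∀ g : EuclideanSpace ℝ ι → ℂ, Measurable g → Integrable (fun ξ => (σ ξ : ℂ) * g ξ) →
      eLpNorm (fun q : ℝ × EuclideanSpace ℝ ι => ((‖q.2‖ ^ (-β) : ℝ) : ℂ) *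
        evolution f (fun ξ => (σ ξ : ℂ) * g ξ) q) 2 ≤ C * eLpNorm g 2)
    {g : EuclideanSpace ℝ ι → ℂ} (hgm : Measurable g) (hg : MemLp g 2) :
    ∃ V : ℝ × EuclideanSpace ℝ ι → ℂ, Measurable V ∧ eLpNorm V 2 ≤ C * eLpNorm g 2 ∧
      ∀ᵐ t : ℝ, MemLp (fun x => V (t, x)) 2 ∧ ∀ ψ : 𝓢(EuclideanSpace ℝ ι, ℂ),
        ∫ x, V (t, x) * (((‖x‖ ^ β : ℝ) : ℂ) * (𝓕 ψ) x) =
          ∫ ξ, (σ ξ : ℂ) * Complex.exp (Complex.I * t * f ξ) * g ξ * ψ ξ := by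
  obtain ⟨gk, hgkm, hgk2, hgkle, hgklim, hgkconv, hint⟩ := exists_seq_integrable_mul hσm hσ hgm hg
  set Wk : ℕ → ℝ × EuclideanSpace ℝ ι → ℂ := fun k q => ((‖q.2‖ ^ (-β) : ℝ) : ℂ) *
    evolution f (fun ξ => (σ ξ : ℂ) * gk k ξ) q with hWk
  have hWm : ∀ k, Measurable (Wk k) := by
    intro k
    have h1 : Measurable (evolution f fun ξ => (σ ξ : ℂ) * gk k ξ) :=
      (stronglyMeasurable_evolution hf (by have := hgkm k; fun_prop)).measurable
    fun_prop
  have hWle : ∀ k, eLpNorm (Wk k) 2 ≤ C * eLpNorm (gk k) 2 := fun k => hC _ (hgkm k) (hint k)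
  have hW2 : ∀ k, MemLp (Wk k) 2 := fun k => ⟨(hWm k).aestronglyMeasurable,
    (hWle k).trans_lt (ENNReal.mul_lt_top ENNReal.coe_lt_top (hgk2 k).2)⟩
  have hWsub : ∀ k l, eLpNorm (Wk k - Wk l) 2 ≤ C * eLpNorm (gk k - gk l) 2 := by
    intro k l
    have e : ∀ ξ, (σ ξ : ℂ) * (gk k - gk l) ξ = (σ ξ : ℂ) * gk k ξ - (σ ξ : ℂ) * gk l ξ := by
      intro ξ
      rw [Pi.sub_apply, mul_sub]
    have h1 := hC (gk k - gk l) ((hgkm k).sub (hgkm l))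
      (by simp only [e]; exact (hint k).sub (hint l))
    simp only [e, evolution_sub hf (hint k) (hint l), mul_sub] at h1
    exact h1
  obtain ⟨V, hVm, hV2, hVle, hconv⟩ :=
    exists_measurable_tendsto_eLpNorm hW2 hgk2 hg hWle hWsub hgkle hgkconv
  refine ⟨V, hVm, hVle, ?_⟩
  obtain ⟨ns, hns, hae⟩ := exists_subseq_ae_tendsto_slice (μ := volume) (ν := volume) hWm hVm
    (by rwa [← Measure.volume_eq_prod])
  have hVs := ae_memLp_two_slice (μ := volume) (ν := volume) hVm
    (by rwa [← Measure.volume_eq_prod])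
  have hWs : ∀ᵐ t : ℝ, ∀ k, MemLp (fun x => Wk k (t, x)) 2 := ae_all_iff.2 fun k =>
    ae_memLp_two_slice (μ := volume) (ν := volume) (hWm k)
      (by rw [← Measure.volume_eq_prod]; exact hW2 k)
  filter_upwards [hae, hVs, hWs] with t ht hVt hWt
  refine ⟨hVt, fun ψ => ?_⟩
  have hv := memLp_norm_rpow_mul_schwartz hβ.le (𝓕 ψ)
  have hl := tendsto_integral_mul_of_tendsto_eLpNorm (fun j => hWt (ns j)) hVt hv ht
  -- the weight cancels outside the origin
  have hk : ∀ k, ∫ x, Wk k (t, x) * (((‖x‖ ^ β : ℝ) : ℂ) * (𝓕 ψ) x) =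
      ∫ ξ, (σ ξ : ℂ) * gk k ξ * (Complex.exp (Complex.I * t * f ξ) * ψ ξ) := by
    intro k
    rw [← integral_evolution_mul_fourier hf (hint k) ψ t]
    refine integral_congr_ae ?_
    filter_upwards [Measure.ae_ne volume (0 : EuclideanSpace ℝ ι)] with x hx
    have hx0 : 0 < ‖x‖ := norm_pos_iff.2 hx
    have h1 : ((‖x‖ ^ (-β) : ℝ) : ℂ) * ((‖x‖ ^ β : ℝ) : ℂ) = 1 := by
      rw [← Complex.ofReal_mul, ← Real.rpow_add hx0]
      simp
    calc _ = (((‖x‖ ^ (-β) : ℝ) : ℂ) * ((‖x‖ ^ β : ℝ) : ℂ)) *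
          (evolution f (fun ξ => (σ ξ : ℂ) * gk k ξ) (t, x) * (𝓕 ψ) x) := by
            simp only [hWk]; ring
      _ = _ := by rw [h1, one_mul]
  have hr : Tendsto (fun k => ∫ ξ, (σ ξ : ℂ) * gk k ξ * (Complex.exp (Complex.I * t * f ξ) * ψ ξ))
      atTop (𝓝 (∫ ξ, (σ ξ : ℂ) * g ξ * (Complex.exp (Complex.I * t * f ξ) * ψ ξ))) := by
    have hσψ := memLp_mul_schwartz hσm hσ ψ
    have hE : ∀ ξ, ‖Complex.exp (Complex.I * t * f ξ)‖ = 1 := by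
      intro ξ
      rw [mul_assoc, mul_comm, ← Complex.ofReal_mul, Complex.norm_exp_ofReal_mul_I]
    refine tendsto_integral_of_dominated_convergence
      (fun ξ => ‖((σ ξ : ℂ) * ψ ξ) * g ξ‖) (fun k => ?_) (hσψ.integrable_mul hg).norm
      (fun k => ae_of_all _ fun ξ => ?_) (ae_of_all _ fun ξ => ?_)
    · have := hgkm k
      have := ψ.continuous.measurable
      exact Measurable.aestronglyMeasurable (by fun_prop)
    · rw [norm_mul, norm_mul, norm_mul, hE, one_mul, norm_mul, norm_mul, mul_right_comm]
      gcongr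
      exact hgkle k ξ
    · refine tendsto_const_nhds.congr' ?_
      filter_upwards [hgklim ξ] with k hk
      rw [hk]
  simp only [hk] at hl
  have heq := tendsto_nhds_unique hl (hr.comp hns.tendsto_atTop)
  rw [heq]
  congr 1
  ext ξ
  ring

end Limit

/-! ### The estimate for `|D_J|^α` -/

lemma exists_eLpNorm_weight_mul_evolution_le {ι : Type*} [Fintype ι] [DecidableEq ι]
    (J : Finset ι) {m α β lam c : ℝ} (hβ : 1 < 2 * β) (hd : 2 * β < J.card) (hm : 0 < m)
    (hmab : m = 2 * α + 2 * β) (hlam : lam ≠ 0) {p : EuclideanSpace ℝ ι → ℝ}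
    (hp : ∀ ξ η : EuclideanSpace ℝ ι, (∀ j ∉ J, ξ j = η j) → p ξ = p η) (hpm : Measurable p) :
    ∃ C : ℝ≥0, ∀ g : EuclideanSpace ℝ ι → ℂ, Measurable g →
      Integrable (fun ξ => ((c * partialNorm J ξ ^ α : ℝ) : ℂ) * g ξ) →
      eLpNorm (fun q : ℝ × EuclideanSpace ℝ ι => ((‖q.2‖ ^ (-β) : ℝ) : ℂ) *
        evolution (fun ξ => lam * partialNorm J ξ ^ m + p ξ)
          (fun ξ => ((c * partialNorm J ξ ^ α : ℝ) : ℂ) * g ξ) q) 2 ≤ C * eLpNorm g 2 := by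
  obtain ⟨C, hC⟩ := exists_lintegral_weight_mul_evolution_le J hβ hd hm hmab hlam hp hpm
  refine ⟨NNReal.sqrt C * ‖c‖₊, fun g hg hint => ?_⟩
  have h := hC (fun ξ => (c : ℂ) * g ξ) _ (by fun_prop) (by fun_prop) hint fun ξ => ?_
  · rw [← ENNReal.pow_le_pow_left_iff (n := 2) two_ne_zero, sq_eLpNorm_two, mul_pow,
      sq_eLpNorm_two]
    refine le_trans (le_of_eq (lintegral_congr fun q => ?_)) (h.trans (le_of_eq ?_))
    · rw [enorm_mul, mul_pow, ← ofReal_norm (Complex.ofReal _), Complex.norm_real,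
        Real.norm_of_nonneg (by positivity)]
    · simp_rw [enorm_mul, mul_pow]
      rw [lintegral_const_mul' _ _ (by finiteness), ← mul_assoc]
      congr 1
      rw [ENNReal.coe_mul, mul_pow, ← ENNReal.coe_pow (NNReal.sqrt C), NNReal.sq_sqrt]
      congr 2
      rw [← ofReal_norm, Complex.norm_real, ofReal_norm]
      rfl
  · rw [enorm_mul, enorm_mul, ← mul_assoc]
    gcongr ?_ * _
    rw [Complex.ofReal_mul, enorm_mul, mul_comm]
    gcongr ?_ * _
    rw [← ofReal_norm, Complex.norm_real,
      Real.norm_of_nonneg (Real.rpow_nonneg (partialNorm_nonneg J ξ) α)]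
    exact ofReal_rpow_le_rpow_ofReal (partialNorm_nonneg J ξ) α

/-- The smoothing estimate for a phase that is a multiple of `|ξ_J|^m` up to a function of the
coordinates outside `J`. -/
theorem weightedSmoothingEstimate_partialNorm {n : ℕ} (J : Finset (Fin n)) {m α lam : ℝ}
    (hm : 0 < m) (h₁ : 1 < m - 2 * α) (h₂ : m - 2 * α < J.card) (hlam : lam ≠ 0)
    {p : EuclideanSpace ℝ (Fin n) → ℝ}
    (hp : ∀ ξ η : EuclideanSpace ℝ (Fin n), (∀ j ∉ J, ξ j = η j) → p ξ = p η)
    (hpm : Measurable p) :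
    WeightedSmoothingEstimate (α - m / 2) (fun ξ => partialNorm J ξ ^ α)
      (fun ξ => lam * partialNorm J ξ ^ m + p ξ) := by
  have hJ : J.Nonempty := by
    rw [← Finset.card_pos]
    have : (0 : ℝ) < J.card := by linarith
    exact_mod_cast this
  have : Nonempty (Fin n) := ⟨hJ.choose⟩
  have h2π : (0 : ℝ) < 2 * Real.pi := by positivity
  set β : ℝ := m / 2 - α with hβ
  have hβ0 : 0 < β := by linarith
  have hκ : α - m / 2 = -β := by ring
  set c : ℝ := (2 * Real.pi) ^ α with hc
  set f : EuclideanSpace ℝ (Fin n) → ℝ := fun ξ =>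
    (lam * (2 * Real.pi) ^ m) * partialNorm J ξ ^ m + p ((2 * Real.pi) • ξ) with hf
  set σ : EuclideanSpace ℝ (Fin n) → ℝ := fun ξ => c * partialNorm J ξ ^ α with hσ
  have hfm : Measurable f := by fun_prop
  have hσm : Measurable σ := by fun_prop
  have hscale : ∀ (ξ : EuclideanSpace ℝ (Fin n)) (a : ℝ),
      partialNorm J ((2 * Real.pi) • ξ) ^ a = (2 * Real.pi) ^ a * partialNorm J ξ ^ a := by
    intro ξ a
    rw [partialNorm_smul, abs_of_pos h2π, Real.mul_rpow h2π.le (partialNorm_nonneg J ξ)]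
  obtain ⟨M, hM⟩ := exists_memLp_partialNorm_rpow_mul_one_add_norm hJ (a := α) (by linarith)
  have hσM : MemLp (fun ξ => σ ξ * (1 + ‖ξ‖) ^ (-(M : ℝ))) 2 := by
    simpa only [hσ, mul_assoc] using hM.const_mul c
  obtain ⟨C, hC⟩ := exists_eLpNorm_weight_mul_evolution_le J (α := α) (β := β) (m := m) (c := c)
    (lam := lam * (2 * Real.pi) ^ m) (p := fun ξ => p ((2 * Real.pi) • ξ)) (by linarith)
    (by linarith) hm (by rw [hβ]; ring) (mul_ne_zero hlam (Real.rpow_pos_of_pos h2π m).ne')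
    (fun ξ η h => hp _ _ fun j hj => by simp [h j hj]) (by fun_prop)
  refine ⟨C, fun φ => ?_⟩
  set g : Lp ℂ 2 (volume : Measure (EuclideanSpace ℝ (Fin n))) := 𝓕 φ with hg
  have hgm : Measurable g := (Lp.stronglyMeasurable g).measurable
  have hg2 : MemLp g 2 := Lp.memLp g
  have hgφ : eLpNorm g 2 = ENNReal.ofReal ‖φ‖ := by
    rw [← Lp.norm_fourier_eq φ, ofReal_norm, Lp.enorm_def]
  obtain ⟨V, hVm, hVle, hV⟩ := exists_weighted_limit_evolution hσm hfm hβ0 hσM hC hgm hg2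
  refine ⟨fun q => ((‖q.2‖ ^ β : ℝ) : ℂ) * V q, ⟨?_, ?_⟩, ?_⟩
  · exact Measurable.aestronglyMeasurable (by fun_prop)
  · filter_upwards [hV] with t ht
    obtain ⟨hVt, hpair⟩ := ht
    intro ψ
    have hσψ := memLp_mul_schwartz hσm hσM ψ
    have hE : ∀ ξ, ‖Complex.exp (Complex.I * t * f ξ)‖ = 1 := by
      intro ξ
      rw [mul_assoc, mul_comm, ← Complex.ofReal_mul, Complex.norm_exp_ofReal_mul_I]
    have hsym : ∀ ξ : EuclideanSpace ℝ (Fin n),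
        ((partialNorm J ((2 * Real.pi) • ξ) ^ α : ℝ) : ℂ) * Complex.exp (Complex.I * t *
          ((lam * partialNorm J ((2 * Real.pi) • ξ) ^ m + p ((2 * Real.pi) • ξ) : ℝ) : ℂ)) =
        (σ ξ : ℂ) * Complex.exp (Complex.I * t * f ξ) := by
      intro ξ
      rw [hscale, hscale, ← mul_assoc lam]
    simp only [hsym]
    have hU : ∀ x, ((‖x‖ ^ β : ℝ) : ℂ) * V (t, x) * (𝓕 ψ) x =
        V (t, x) * (((‖x‖ ^ β : ℝ) : ℂ) * (𝓕 ψ) x) := fun x => by ring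
    refine ⟨?_, ?_, ?_⟩
    · simp only [hU]
      exact hVt.integrable_mul (memLp_norm_rpow_mul_schwartz hβ0.le (𝓕 ψ))
    · have h3 := (hσψ.integrable_mul hg2).bdd_mul (c := 1)
        (f := fun ξ => Complex.exp (Complex.I * t * f ξ))
        (Measurable.aestronglyMeasurable (by fun_prop)) (ae_of_all _ fun ξ => (hE ξ).le)
      refine h3.congr (ae_of_all _ fun ξ => ?_)
      simp only [Pi.mul_apply]
      ring
    · simp only [hU]
      exact hpair ψ
  · rw [← hgφ]
    refine le_trans (eLpNorm_mono fun q => ?_) hVle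
    rw [hκ, ← mul_assoc, norm_mul, ← Complex.ofReal_mul, Complex.norm_real]
    refine mul_le_of_le_one_left (norm_nonneg _) ?_
    rcases (norm_nonneg q.2).eq_or_lt with h0 | h0
    · rw [← h0, Real.zero_rpow hβ0.ne']
      simp
    · rw [← Real.rpow_add h0]
      simp

end

theorem mainTheorem9 (n : ℕ) [NeZero n] (m α : ℝ) (hm : 0 < m) :
    ((m - n) / 2 < α → α < (m - 1) / 2 →
      WeightedSmoothingEstimate (n := n) (α - m / 2) (fun ξ => ‖ξ‖ ^ α) (fun ξ => ‖ξ‖ ^ m)) ∧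
    ((m - n + 1) / 2 < α → α < (m - 1) / 2 →
      WeightedSmoothingEstimate (n := n) (α - m / 2) (fun ξ => tailNorm ξ ^ α)
        (fun ξ => |ξ 0| ^ m - tailNorm ξ ^ m)) := by
  refine ⟨fun h₁ h₂ => ?_, fun h₁ h₂ => ?_⟩
  · have h := weightedSmoothingEstimate_partialNorm (n := n) Finset.univ (lam := 1) (p := fun _ => 0)
      hm (α := α) (by linarith) (by simp; linarith) one_ne_zero (fun _ _ _ => rfl) measurable_const
    simpa only [partialNorm_univ, one_mul, add_zero] using h
  · have hcard : ((Finset.univ.erase (0 : Fin n)).card : ℝ) = n - 1 := by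
      rw [Finset.card_erase_of_mem (Finset.mem_univ _), Finset.card_univ, Fintype.card_fin,
        Nat.cast_pred (NeZero.pos n)]
    have h := weightedSmoothingEstimate_partialNorm (n := n) (Finset.univ.erase 0) (lam := -1)
      (p := fun ξ => |ξ 0| ^ m) hm (α := α) (by linarith) (by rw [hcard]; linarith) (by norm_num)
      (fun ξ η h => by rw [h 0 (Finset.notMem_erase _ _)]) (by fun_prop)
    have hf : (fun ξ : EuclideanSpace ℝ (Fin n) => |ξ 0| ^ m - tailNorm ξ ^ m) =
        fun ξ => -1 * partialNorm (Finset.univ.erase 0) ξ ^ m + |ξ 0| ^ m := by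
      ext ξ
      change _ - partialNorm (Finset.univ.erase 0) ξ ^ m = _
      ring
    rw [hf]
    exact h
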